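/- **Setting.** Let $(\nu_a)_{a\in\mathcal M}$ be a canonical one-parameter exponential family on $\mathbb R$ parametrized by its mean: its members are the laws $\propto e^{\theta x}\rho(dx)$, with $\theta$ in an open interval on which $\int e^{\theta x}\rho(dx)<\infty$, where $\rho$ is not concentrated at one point, and $\mathcal M$ is the set of their means. Write $d(a,b)=\mathrm{KL}(\nu_a,\nu_b)$, and let $d_B(p,q)$ be the Kullback–Leibler divergence between Bernoulli laws of means $p,q$. Let $K\ge 2$ and $\gamma\in\mathcal M$. For $\lambda\in\mathcal M^K$ put $\lambda_\star=\min_k\lambda_k$; we consider the set $\mathcal L$ of those $\lambda\in\mathcal M^K$ for which $\arg\min_k\lambda_k$ is a single slice and $\lambda_\star\ne\gamma$. The least-loaded-slice criterion has the set of correct answers $\mathcal C(\lambda)=\arg\min_k\lambda_k$ if $\lambda_\star<\gamma$, and $\mathcal C(\lambda)=\{0\}$ (reject) otherwise. Under $\mathbb P_\lambda$ the variables $X_k(t)$ ($1\le k\le K$, $t\ge1$) are independent with $X_k(t)\sim\nu_{\lambda_k}$. An algorithm selects in each slot $t$ a slice $k_t$ that is $\mathcal F_{t-1}$-measurable, where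 $\mathcal F_t=\sigma(k_1,X_{k_1}(1),\dots,k_t,X_{k_t}(t))$; it stops at a stopping time $\tau$ of $(\mathcal F_t)$ and returns an $\mathcal F_\tau$-measurable decision $\hat k\in\{0,1,\dots,K\}$. It is $\delta$-PC if $\mathbb P_\lambda[\tau<\infty]=1$ and $\mathbb P_\lambda[\hat k\notin\mathcal C(\lambda)]\le\delta$ for every $\lambda\in\mathcal L$. For $\mu\in\mathcal L$ and $j\neq k$ with $\mu_j\ne\mu_k$ put, for $x\ge0$, $$g_{j,k}(x)=d\Big(\mu_k,\tfrac{\mu_k+x\mu_j}{1+x}\Big)+x\,d\Big(\mu_j,\tfrac{\mu_k+x\mu_j}{1+x}\Big),$$ let $x_{j,k}=g_{j,k}^{-1}$ be its inverse, let $x_{k,k}\equiv1$ by convention, and let $$F_k(y;S)=\sum_{j\in S}\frac{d\big(\mu_k,(\mu_k+x_{j,k}(y)\mu_j)/(1+x_{j,k}(y))\big)}{d\big(\mu_j,(\mu_k+x_{j,k}(y)\mu_j)/(1+x_{j,k}(y))\big)} .$$ **Proposition (least-loaded slice).** Let $\mu\in\mathcal L$ with $\mathcal C(\mu)\neq\{0\}$,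 let $k_\star$ be the least loaded slice, $\mu_\star=\mu_{k_\star}$ and $\mathcal S_{LL}=\{j:\mu_j>\mu_\star\}$. The equation $F_{k_\star}(y;\mathcal S_{LL})=1$ has a unique solution $y_\star$ (among the $y$ at which all $x_{j,k_\star}$, $j\in\mathcal S_{LL}$, are defined). Put $$z_\star=\min(d(\mu_\star,\gamma),y_\star),\qquad T_3(\mu)=\frac1{z_\star}\sum_{k=1}^K x_{k,k_\star}(z_\star),\qquad w^\star_k(\mu)=\frac{x_{k,k_\star}(z_\star)}{z_\star T_3(\mu)} .$$ Then for every $\delta\in(0,1/2]$ every $\delta$-PC algorithm satisfies $$\mathbb E_\mu[\tau]\ \ge\ T_3(\mu)\,d_B(\delta,1-\delta).$$ Moreover $w^\star(\mu)$ is the optimal measurement process: it lies in the simplex $\Lambda=\{w\in[0,1]^K:\sum_kw_k=1\}$ and is the unique maximizer over $w\in\Lambda$ of $$\inf_{\lambda\in\mathcal L:\ k_\star\notin\mathcal C(\lambda)}\ \sum_{k=1}^K w_k\,d(\mu_k,\lambda_k),$$ and the maximal value is $T_3(\mu)^{-1}$. -/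

import Mathlib

open MeasureTheory ProbabilityTheory

noncomputable section

/-- A (canonical) one-parameter exponential family on `ℝ`: the laws
`dν_θ(x) = exp (θ x - b(θ)) dρ(x)`, where the natural parameter `θ` ranges over an open interval
on which the normalizing integral converges, and the reference measure `ρ` is not concentrated
at one point. -/
structure ExpFamily where
  ρ : Measure ℝ
  Θ : Set ℝ
  isOpen_Θ : IsOpen Θ
  ordConnected_Θ : Θ.OrdConnected
  integrable_exp : ∀ θ ∈ Θ, Integrable (fun x : ℝ => Real.exp (θ * x)) ρ
  nondegenerate : ∀ c : ℝ, ρ {c}ᶜ ≠ 0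

namespace ExpFamily

variable (E : ExpFamily)

/-- The law with natural parameter `θ`: density `exp (θ x) / ∫ exp (θ x) dρ` w.r.t. `ρ`. -/
def natLaw (θ : ℝ) : Measure ℝ := E.ρ.tilted (fun x => θ * x)

/-- The mean of the law with natural parameter `θ`. -/
def mean (θ : ℝ) : ℝ := ∫ x, x ∂(E.natLaw θ)

/-- The set of means of the laws of the family. -/
def means : Set ℝ := E.mean '' E.Θ

/-- The natural parameter in `Θ` of the law with mean `a`, for `a ∈ E.means`. -/
def natParam (a : ℝ) : ℝ := Function.invFunOn E.mean E.Θ a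

open Classical in
/-- The law of the family with mean `a`, for `a ∈ E.means`. (Outside of `E.means` there is no such
law; a point mass is put there only so that the value is always a probability measure.) -/
def law (a : ℝ) : Measure ℝ :=
  if a ∈ E.means then E.natLaw (E.natParam a) else Measure.dirac a

instance isProbabilityMeasure_law (a : ℝ) : IsProbabilityMeasure (E.law a) := by
  unfold law
  split_ifs with h
  · have hmem : E.natParam a ∈ E.Θ := Function.invFunOn_mem h
    have : NeZero E.ρ := ⟨fun h0 => E.nondegenerate 0 (by simp [h0])⟩
    exact isProbabilityMeasure_tilted (E.integrable_exp _ hmem)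
  · infer_instance

/-- `d(a, b)`: the Kullback-Leibler divergence between the laws with means `a` and `b`. -/
def d (a b : ℝ) : ℝ := (InformationTheory.klDiv (E.law a) (E.law b)).toReal

end ExpFamily

/-- `d_B(p, q)`: the Kullback-Leibler divergence between the Bernoulli laws with means `p`, `q`. -/
def bernoulliKL (p q : unitInterval) : ℝ :=
  (InformationTheory.klDiv (bernoulliMeasure (1 : ℝ) 0 p) (bernoulliMeasure (1 : ℝ) 0 q)).toReal

/-- Correct answers for the least-loaded-slice criterion with loads `l` and threshold `γ`.
`some k` means "admit on slice `k`", `none` means "reject". -/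
def correctAnswers {K : ℕ} (γ : ℝ) (l : Fin K → ℝ) : Set (Option (Fin K)) :=
  {a | match a with
    | none => ∀ k, γ ≤ l k
    | some k => l k < γ ∧ ∀ j, l k ≤ l j}

/-- The load vectors under consideration: every load is a mean of the family, the least loaded
slice is unique, and the smallest load differs from the threshold. -/
def loadModels (E : ExpFamily) (K : ℕ) (γ : ℝ) : Set (Fin K → ℝ) :=
  {l | (∀ k, l k ∈ E.means) ∧ (∃! k, ∀ j, l k ≤ l j) ∧ ∀ k, (∀ j, l k ≤ l j) → l k ≠ γ}

/-! ### Measurement and decision algorithms -/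

/-- Outcomes: `ω t k` is the number of packets `X_k(t+1)` of slice `k` in slot `t + 1`
(slots are counted from `0` here). -/
abbrev Outcome (K : ℕ) : Type := ℕ → Fin K → ℝ

/-- The distribution `ℙ_l` of the outcomes: all `X_k(t)` are independent, and `X_k(t)` has the
law of the family with mean `l k`. -/
def outcomeMeasure (E : ExpFamily) {K : ℕ} (l : Fin K → ℝ) : Measure (Outcome K) :=
  Measure.infinitePi fun _ : ℕ => Measure.pi fun k : Fin K => E.law (l k)

/-- The slice measured in slot `s`, together with the value observed there. -/
def observation {K : ℕ} (slice : ℕ → Outcome K → Fin K) (s : ℕ) (ω : Outcome K) : Fin K × ℝ :=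
  (slice s ω, ω s (slice s ω))

/-- The `σ`-algebra generated by the first `t` observations. -/
@[reducible] def history {K : ℕ} (slice : ℕ → Outcome K → Fin K) (t : ℕ) : MeasurableSpace (Outcome K) :=
  ⨆ s : Fin t, MeasurableSpace.comap (observation slice s) inferInstance

theorem history_le {K : ℕ} (slice : ℕ → Outcome K → Fin K)
    (h : ∀ t, Measurable[history slice t] (slice t)) (t : ℕ) :
    history slice t ≤ (inferInstance : MeasurableSpace (Outcome K)) := by
  induction t using Nat.strong_induction_on with
  | _ t ih =>
    refine iSup_le fun s => ?_
    have hs : Measurable (slice s) := (h s).mono (ih s s.2) le_rfl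
    have he : Measurable (fun p : Fin K × (Fin K → ℝ) => p.2 p.1) :=
      measurable_from_prod_countable_right fun k => measurable_pi_apply k
    have hv : Measurable (fun ω : Outcome K => ω s (slice s ω)) :=
      he.comp (hs.prodMk (measurable_pi_apply (s : ℕ)))
    exact (hs.prodMk hv).comap_le

/-- The filtration of the observations. -/
def historyFiltration {K : ℕ} (slice : ℕ → Outcome K → Fin K)
    (h : ∀ t, Measurable[history slice t] (slice t)) :
    Filtration ℕ (inferInstance : MeasurableSpace (Outcome K)) where
  seq := history slice
  mono' := fun _ t hst => iSup_le fun i =>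
    le_iSup (fun j : Fin t => MeasurableSpace.comap (observation slice j) inferInstance)
      (Fin.castLE hst i)
  le' := history_le slice h

/-- A joint measurement and decision algorithm: a sampling strategy (the slice measured next is a
measurable function of the past observations), a stopping time for the filtration of the
observations, and a decision that is measurable for the `σ`-algebra of the stopping time. -/
structure Algorithm (K : ℕ) where
  slice : ℕ → Outcome K → Fin K
  measurable_slice : ∀ t, Measurable[history slice t] (slice t)
  τ : Outcome K → ℕ∞
  isStoppingTime : IsStoppingTime (historyFiltration slice measurable_slice) τ
  decision : Outcome K → Option (Fin K)
  measurable_decision : Measurable[isStoppingTime.measurableSpace, ⊤] decision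

namespace Algorithm

variable {K : ℕ} (A : Algorithm K)

/-- `δ`-probably correct algorithms. -/
def IsPC (E : ExpFamily) (γ δ : ℝ) : Prop :=
  ∀ l ∈ loadModels E K γ,
    outcomeMeasure E l {ω | A.τ ω < ⊤} = 1 ∧
    outcomeMeasure E l {ω | A.decision ω ∉ correctAnswers γ l} ≤ ENNReal.ofReal δ

/-- The sample complexity `𝔼_l[τ]`. -/
def sampleComplexity (E : ExpFamily) (l : Fin K → ℝ) : ENNReal :=
  ∫⁻ ω, (A.τ ω : ENNReal) ∂(outcomeMeasure E l)

end Algorithm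

/-! ### The quantities in the lower bound -/

/-- The load vectors for which `a` is not a correct answer. -/
def alternatives (E : ExpFamily) (K : ℕ) (γ : ℝ) (a : Option (Fin K)) : Set (Fin K → ℝ) :=
  {l | l ∈ loadModels E K γ ∧ a ∉ correctAnswers γ l}

/-- `inf_l ∑ k, w_k d(μ_k, l_k)` over the load vectors `l` for which `a` is not correct. -/
def informationRate (E : ExpFamily) {K : ℕ} (γ : ℝ) (μ : Fin K → ℝ) (a : Option (Fin K))
    (w : Fin K → ℝ) : ℝ :=
  ⨅ l : alternatives E K γ a, ∑ k, w k * E.d (μ k) (l.1 k)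

/-- `(μ_k + x μ_j) / (1 + x)`. -/
def mixedMean {K : ℕ} (μ : Fin K → ℝ) (j k : Fin K) (x : ℝ) : ℝ := (μ k + x * μ j) / (1 + x)

/-- The information deviation function `g_{j,k}`, a function on `[0, ∞)`. -/
def deviation (E : ExpFamily) {K : ℕ} (μ : Fin K → ℝ) (j k : Fin K) (x : ℝ) : ℝ :=
  E.d (μ k) (mixedMean μ j k x) + x * E.d (μ j) (mixedMean μ j k x)

/-- `x_{j,k}`, the inverse of `g_{j,k} : [0, ∞) → ℝ`, with the convention `x_{k,k} = 1`
(`g_{k,k}` vanishes identically and has no inverse). -/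
def deviationInv (E : ExpFamily) {K : ℕ} (μ : Fin K → ℝ) (j k : Fin K) (y : ℝ) : ℝ :=
  if j = k then 1 else Function.invFunOn (deviation E μ j k) (Set.Ici 0) y

/-- The equilibrium function `F_k(y; S)`. -/
def equilibrium (E : ExpFamily) {K : ℕ} (μ : Fin K → ℝ) (k : Fin K) (S : Finset (Fin K))
    (y : ℝ) : ℝ :=
  ∑ j ∈ S, E.d (μ k) (mixedMean μ j k (deviationInv E μ j k y)) /
    E.d (μ j) (mixedMean μ j k (deviationInv E μ j k y))

/-- `y` solves `F_k(y; S) = 1`: every `x_{j,k}(y)`, `j ∈ S`, is defined and the equation holds. -/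
def IsEquilibrium (E : ExpFamily) {K : ℕ} (μ : Fin K → ℝ) (k : Fin K) (S : Finset (Fin K))
    (y : ℝ) : Prop :=
  (∀ j ∈ S, y ∈ deviation E μ j k '' Set.Ici 0) ∧ equilibrium E μ k S y = 1

/-- The slices with a load larger than that of `k`. -/
def moreLoaded {K : ℕ} (μ : Fin K → ℝ) (k : Fin K) : Finset (Fin K) :=
  Finset.univ.filter fun j => μ k < μ j

/-- `T = (1 / z) ∑ k, x_{k,k₀}(z)`. -/
def characteristicTime (E : ExpFamily) {K : ℕ} (μ : Fin K → ℝ) (k₀ : Fin K) (z : ℝ) : ℝ :=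
  (1 / z) * ∑ k, deviationInv E μ k k₀ z

/-- `w_k = x_{k,k₀}(z) / (z T)`. -/
def proportions (E : ExpFamily) {K : ℕ} (μ : Fin K → ℝ) (k₀ : Fin K) (z : ℝ) : Fin K → ℝ :=
  fun k => deviationInv E μ k k₀ z / (z * characteristicTime E μ k₀ z)

end

noncomputable section

/-! Because `E.d a` is continuous on the means, a bound valid on all alternatives extends to their
closure (`mem_closure_alternatives`). Two kinds of move decide there: raising the load of `k₀` to
`γ`, or bringing `k₀` and one slice `j` to a common mean. By the compensation identity
`weighted_d_eq` the second move is cheapest at the weighted mean, with cost `w k₀ * deviation E μ j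
k₀ (w j / w k₀)`. Normalizing `w k₀ = 1` and asking every pair cost to equal `z` gives the weights
`deviationInv`; the threshold move only asks `z ≤ d(μ k₀, γ)`.

The level `z` is justified by Lagrange multipliers, without differentiation. Let `A j`, `B j` be the
divergences from `μ k₀` and `μ j` to the mixed mean at level `z`, and `F = ∑ A j / B j`. The pair
constraints with multipliers `1 / B j` and the threshold constraint with multiplier `(1 - F) / z`
add up to `r * T ≤ ∑ k, w k` (`mul_characteristicTime_le`). At the chosen `z`, either `F = 1` and
the threshold drops out, or `z = d(μ k₀, γ)`. `le_of_mem_alternatives` shows that the bound is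
attained; tightness of the pair constraints yields uniqueness (`IsOptimalLevel.informationRate_lt`).

For the sample complexity, the same dual inequality is applied to the expected numbers of
measurements before `min τ n`. Change of measure and a Donsker–Varadhan bound
(`Algorithm.mul_measureReal_sub_log_le`) give these counts the same amount of information against
every alternative, and that amount tends to a quantity at least the Bernoulli divergence as `n → ∞`.
-/

theorem toReal_klDiv_tilted_left_self {α : Type*} {mα : MeasurableSpace α} {ν : Measure α}
    [IsProbabilityMeasure ν] {f : α → ℝ} (hf : Integrable (fun x => Real.exp (f x)) ν)
    (hfi : Integrable f (ν.tilted f)) :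
    (InformationTheory.klDiv (ν.tilted f) ν).toReal
      = ∫ x, f x ∂(ν.tilted f) - Real.log (∫ x, Real.exp (f x) ∂ν) := by
  have := isProbabilityMeasure_tilted hf
  rw [InformationTheory.toReal_klDiv_of_measure_eq (tilted_absolutelyContinuous ν f) (by simp)]
  have h : llr (ν.tilted f) ν =ᵐ[ν.tilted f] fun x => f x - Real.log (∫ x, Real.exp (f x) ∂ν) :=
    (tilted_absolutelyContinuous ν f).ae_le (log_rnDeriv_tilted_left_self hf)
  rw [integral_congr_ae h, integral_sub hfi (integrable_const _)]
  simp

/-! ### Divergences in an exponential family parametrized by the mean. -/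

namespace ExpFamily

variable (E : ExpFamily)

instance neZero_ρ : NeZero E.ρ := ⟨fun h0 => E.nondegenerate 0 (by simp [h0])⟩

/-- The log-partition function of the family. -/
def logPartition (θ : ℝ) : ℝ := cgf id E.ρ θ

variable {E}

theorem isProbabilityMeasure_natLaw {θ : ℝ} (hθ : θ ∈ E.Θ) : IsProbabilityMeasure (E.natLaw θ) :=
  isProbabilityMeasure_tilted (E.integrable_exp _ hθ)

theorem mem_interior_integrableExpSet {θ : ℝ} (hθ : θ ∈ E.Θ) :
    θ ∈ interior (integrableExpSet id E.ρ) :=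
  interior_maximal (fun _ ht => E.integrable_exp _ ht) E.isOpen_Θ hθ

theorem integrable_id_natLaw {θ : ℝ} (hθ : θ ∈ E.Θ) : Integrable (fun x => x) (E.natLaw θ) :=
  memLp_one_iff_integrable.1 (memLp_tilted_mul (X := id) (mem_interior_integrableExpSet hθ) 1)

theorem mean_eq_deriv {θ : ℝ} (hθ : θ ∈ E.Θ) : E.mean θ = deriv E.logPartition θ :=
  integral_tilted_mul_self (X := id) (mem_interior_integrableExpSet hθ)

theorem continuousOn_logPartition : ContinuousOn E.logPartition E.Θ := fun _ hθ =>
  (analyticAt_cgf (mem_interior_integrableExpSet hθ)).continuousAt.continuousWithinAt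

theorem continuousOn_mean : ContinuousOn E.mean E.Θ := by
  refine ContinuousOn.congr (f := deriv E.logPartition) (fun θ hθ => ?_)
    fun θ hθ => mean_eq_deriv hθ
  exact (analyticAt_cgf (mem_interior_integrableExpSet hθ)).deriv.continuousAt.continuousWithinAt

theorem natLaw_eq_tilted {θ η : ℝ} (hη : η ∈ E.Θ) :
    E.natLaw θ = (E.natLaw η).tilted (fun x => (θ - η) * x) := by
  rw [natLaw, natLaw, tilted_tilted (E.integrable_exp _ hη)]
  congr 1
  ext x
  simp only [Pi.add_apply]
  ring

theorem integrable_exp_sub_mul {θ η : ℝ} (hθ : θ ∈ E.Θ) (hη : η ∈ E.Θ) :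
    Integrable (fun x => Real.exp ((θ - η) * x)) (E.natLaw η) := by
  rw [natLaw, integrable_tilted_iff (E.integrable_exp _ hη)]
  refine (E.integrable_exp _ hθ).congr (Filter.Eventually.of_forall fun x => ?_)
  simp only [smul_eq_mul, ← Real.exp_add]
  congr 1; ring

theorem log_integral_exp_sub_mul {θ η : ℝ} (hθ : θ ∈ E.Θ) (hη : η ∈ E.Θ) :
    Real.log (∫ x, Real.exp ((θ - η) * x) ∂(E.natLaw η)) = E.logPartition θ - E.logPartition η := by
  rw [natLaw, integral_exp_tilted, Real.log_div]
  · simp only [logPartition, cgf, mgf, id]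
    congr 4
    ext x
    simp only [Pi.add_apply]
    congr 1; ring
  · have : (fun x : ℝ => η * x) + (fun x => (θ - η) * x) = fun x => θ * x := by
      ext x; simp only [Pi.add_apply]; ring
    rw [this]
    exact (integral_exp_pos (E.integrable_exp _ hθ)).ne'
  · exact (integral_exp_pos (E.integrable_exp _ hη)).ne'

theorem toReal_klDiv_natLaw {θ η : ℝ} (hθ : θ ∈ E.Θ) (hη : η ∈ E.Θ) :
    (InformationTheory.klDiv (E.natLaw θ) (E.natLaw η)).toReal
      = (θ - η) * E.mean θ - (E.logPartition θ - E.logPartition η) := by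
  have := isProbabilityMeasure_natLaw hη
  have hint := integrable_id_natLaw hθ
  rw [← log_integral_exp_sub_mul hθ hη, mean, ← integral_const_mul]
  rw [natLaw_eq_tilted (θ := θ) hη] at hint ⊢
  exact toReal_klDiv_tilted_left_self (integrable_exp_sub_mul hθ hη) (hint.const_mul _)

theorem klDiv_natLaw_ne_top {θ η : ℝ} (hθ : θ ∈ E.Θ) (hη : η ∈ E.Θ) :
    InformationTheory.klDiv (E.natLaw θ) (E.natLaw η) ≠ ⊤ := by
  have := isProbabilityMeasure_natLaw hη
  have hint := integrable_id_natLaw hθ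
  rw [natLaw_eq_tilted (θ := θ) hη] at hint ⊢
  have hi := integrable_exp_sub_mul hθ hη
  have : IsProbabilityMeasure ((E.natLaw η).tilted fun x => (θ - η) * x) :=
    isProbabilityMeasure_tilted hi
  refine InformationTheory.klDiv_ne_top (tilted_absolutelyContinuous _ _) ?_
  have h : llr ((E.natLaw η).tilted fun x => (θ - η) * x) (E.natLaw η)
      =ᵐ[(E.natLaw η).tilted fun x => (θ - η) * x] fun x => (θ - η) * x
        - Real.log (∫ x, Real.exp ((θ - η) * x) ∂(E.natLaw η)) :=
    (tilted_absolutelyContinuous _ _).ae_le (log_rnDeriv_tilted_left_self hi)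
  exact ((hint.const_mul (θ - η)).sub (integrable_const _)).congr h.symm

/-- If two laws coincide, their log-likelihood ratio, an affine function of slope `θ - η`, vanishes
almost everywhere. For `θ ≠ η` this concentrates `ρ` at the single zero. -/
theorem injOn_natLaw : Set.InjOn E.natLaw E.Θ := by
  intro θ hθ η hη h
  by_contra hne
  have := isProbabilityMeasure_natLaw hη
  have h1 := log_rnDeriv_tilted_left_self (integrable_exp_sub_mul hθ hη)
  rw [← natLaw_eq_tilted hη, h] at h1
  have h2 := (absolutelyContinuous_tilted (E.integrable_exp _ hη)).ae_le
    (h1.symm.trans (llr_self (E.natLaw η)))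
  set c := Real.log (∫ x, Real.exp ((θ - η) * x) ∂(E.natLaw η))
  refine E.nondegenerate (c / (θ - η)) ?_
  change ∀ᵐ x ∂E.ρ, x ∈ ({c / (θ - η)} : Set ℝ)
  filter_upwards [h2] with x hx
  have hd : θ - η ≠ 0 := sub_ne_zero.2 hne
  simp only [Pi.zero_apply] at hx
  rw [Set.mem_singleton_iff, eq_div_iff hd]
  linarith

/-- In the sum of the divergences in both directions the log-partition terms cancel, and `(η - θ) *
(E.mean η - E.mean θ)` remains; it is positive by injectivity. -/
theorem strictMonoOn_mean : StrictMonoOn E.mean E.Θ := by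
  intro θ hθ η hη hlt
  have hp : ∀ {s t : ℝ}, s ∈ E.Θ → t ∈ E.Θ → s ≠ t →
      0 < (InformationTheory.klDiv (E.natLaw s) (E.natLaw t)).toReal := by
    intro s t hs ht hst
    have := isProbabilityMeasure_natLaw hs
    have := isProbabilityMeasure_natLaw ht
    refine ENNReal.toReal_pos (fun h => hst (injOn_natLaw hs ht ?_)) (klDiv_natLaw_ne_top hs ht)
    exact InformationTheory.klDiv_eq_zero_iff.1 h
  have h1 := hp hθ hη hlt.ne
  have h2 := hp hη hθ hlt.ne'
  rw [toReal_klDiv_natLaw hθ hη] at h1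
  rw [toReal_klDiv_natLaw hη hθ] at h2
  have : 0 < (η - θ) * (E.mean η - E.mean θ) := by nlinarith
  have := (mul_pos_iff_of_pos_left (sub_pos.2 hlt)).1 this
  linarith

theorem natParam_mem {a : ℝ} (ha : a ∈ E.means) : E.natParam a ∈ E.Θ := Function.invFunOn_mem ha

theorem mean_natParam {a : ℝ} (ha : a ∈ E.means) : E.mean (E.natParam a) = a :=
  Function.invFunOn_eq ha

theorem natParam_mean {θ : ℝ} (hθ : θ ∈ E.Θ) : E.natParam (E.mean θ) = θ :=
  strictMonoOn_mean.injOn (natParam_mem ⟨θ, hθ, rfl⟩) hθ (mean_natParam ⟨θ, hθ, rfl⟩)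

theorem strictMonoOn_natParam : StrictMonoOn E.natParam E.means := by
  intro a ha b hb hab
  rwa [← strictMonoOn_mean.lt_iff_lt (natParam_mem ha) (natParam_mem hb), mean_natParam ha,
    mean_natParam hb]

theorem ordConnected_means : E.means.OrdConnected :=
  ((E.ordConnected_Θ.isPreconnected).image _ continuousOn_mean).ordConnected

theorem isOpen_means : IsOpen E.means := by
  rw [isOpen_iff_mem_nhds]
  rintro _ ⟨θ, hθ, rfl⟩
  obtain ⟨ε, hε, hsub⟩ := Metric.isOpen_iff.1 E.isOpen_Θ θ hθ
  have hl : θ - ε / 2 ∈ E.Θ := hsub (by simp [abs_of_pos hε]; linarith)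
  have hr : θ + ε / 2 ∈ E.Θ := hsub (by simp [abs_of_pos hε]; linarith)
  refine Filter.mem_of_superset (Icc_mem_nhds (strictMonoOn_mean hl hθ (by linarith))
    (strictMonoOn_mean hθ hr (by linarith))) (ordConnected_means.out ⟨_, hl, rfl⟩ ⟨_, hr, rfl⟩)

theorem continuousAt_natParam {a : ℝ} (ha : a ∈ E.means) : ContinuousAt E.natParam a := by
  refine strictMonoOn_natParam.continuousAt_of_image_mem_nhds (isOpen_means.mem_nhds ha) ?_
  refine Filter.mem_of_superset (E.isOpen_Θ.mem_nhds (natParam_mem ha)) fun θ hθ => ?_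
  exact ⟨E.mean θ, ⟨θ, hθ, rfl⟩, natParam_mean hθ⟩

theorem law_eq {a : ℝ} (ha : a ∈ E.means) : E.law a = E.natLaw (E.natParam a) := by
  simp [law, ha]

theorem integrable_id_law {a : ℝ} (ha : a ∈ E.means) : Integrable (fun x => x) (E.law a) := by
  rw [law_eq ha]; exact integrable_id_natLaw (natParam_mem ha)

theorem integral_id_law {a : ℝ} (ha : a ∈ E.means) : ∫ x, x ∂(E.law a) = a := by
  rw [law_eq ha]; exact mean_natParam ha

theorem d_eq {a b : ℝ} (ha : a ∈ E.means) (hb : b ∈ E.means) :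
    E.d a b = (E.natParam a - E.natParam b) * a
      - (E.logPartition (E.natParam a) - E.logPartition (E.natParam b)) := by
  rw [d, law_eq ha, law_eq hb, toReal_klDiv_natLaw (natParam_mem ha) (natParam_mem hb),
    mean_natParam ha]

theorem d_nonneg (a b : ℝ) : 0 ≤ E.d a b := ENNReal.toReal_nonneg

theorem d_self (a : ℝ) : E.d a a = 0 := by simp [d]

theorem d_pos {a b : ℝ} (ha : a ∈ E.means) (hb : b ∈ E.means) (hab : a ≠ b) : 0 < E.d a b := by
  refine ENNReal.toReal_pos (fun h => hab ?_) ?_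
  · rw [← integral_id_law ha, ← integral_id_law hb, InformationTheory.klDiv_eq_zero_iff.1 h]
  · rw [law_eq ha, law_eq hb]
    exact klDiv_natLaw_ne_top (natParam_mem ha) (natParam_mem hb)

theorem continuousAt_d_right {a b : ℝ} (ha : a ∈ E.means) (hb : b ∈ E.means) :
    ContinuousAt (E.d a) b := by
  have h1 := continuousAt_natParam hb
  have h2 : ContinuousAt E.logPartition (E.natParam b) :=
    continuousOn_logPartition.continuousAt (E.isOpen_Θ.mem_nhds (natParam_mem hb))
  have h3 : ContinuousAt (fun x => E.logPartition (E.natParam x)) b := h2.comp h1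
  refine ContinuousAt.congr (f := fun x => (E.natParam a - E.natParam x) * a
      - (E.logPartition (E.natParam a) - E.logPartition (E.natParam x))) (by fun_prop) ?_
  filter_upwards [isOpen_means.mem_nhds hb] with x hx
  exact (d_eq ha hx).symm

/-- The three-point identity for the divergence. -/
theorem d_add_d {a b c : ℝ} (ha : a ∈ E.means) (hb : b ∈ E.means) (hc : c ∈ E.means) :
    E.d a c = E.d a b + E.d b c + (E.natParam c - E.natParam b) * (b - a) := by
  rw [d_eq ha hc, d_eq ha hb, d_eq hb hc]; ring

/-- In the three-point identity through `b` the cross term is nonnegative, since `natParam` is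
increasing, and `d b c` is positive. -/
theorem d_lt_d_of_le_of_lt {a b c : ℝ} (ha : a ∈ E.means) (hb : b ∈ E.means) (hc : c ∈ E.means)
    (hab : a ≤ b) (hbc : b < c) : E.d a b < E.d a c := by
  have h1 := d_pos hb hc hbc.ne
  have h2 := strictMonoOn_natParam hb hc hbc
  rw [d_add_d ha hb hc]
  nlinarith [mul_nonneg (sub_nonneg.2 h2.le) (sub_nonneg.2 hab)]

theorem d_lt_d_of_lt_of_le {a b c : ℝ} (ha : a ∈ E.means) (hb : b ∈ E.means) (hc : c ∈ E.means)
    (hcb : c < b) (hba : b ≤ a) : E.d a b < E.d a c := by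
  have h1 := d_pos hb hc hcb.ne'
  have h2 := strictMonoOn_natParam hc hb hcb
  rw [d_add_d ha hb hc]
  nlinarith [mul_nonneg (sub_nonneg.2 h2.le) (sub_nonneg.2 hba)]

theorem d_le_d_of_le_of_le {a b c : ℝ} (ha : a ∈ E.means) (hb : b ∈ E.means) (hc : c ∈ E.means)
    (hab : a ≤ b) (hbc : b ≤ c) : E.d a b ≤ E.d a c := by
  rcases hbc.eq_or_lt with rfl | h
  · rfl
  · exact (d_lt_d_of_le_of_lt ha hb hc hab h).le

theorem d_le_d_of_ge_of_ge {a b c : ℝ} (ha : a ∈ E.means) (hb : b ∈ E.means) (hc : c ∈ E.means)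
    (hcb : c ≤ b) (hba : b ≤ a) : E.d a b ≤ E.d a c := by
  rcases hcb.eq_or_lt with rfl | h
  · rfl
  · exact (d_lt_d_of_lt_of_le ha hb hc h hba).le

/-- The compensation identity: the weighted mean minimizes the weighted sum of divergences. -/
theorem weighted_d_eq {a b m c u v : ℝ} (ha : a ∈ E.means) (hb : b ∈ E.means) (hm : m ∈ E.means)
    (hc : c ∈ E.means) (h : (u + v) * m = u * a + v * b) :
    u * E.d a c + v * E.d b c = u * E.d a m + v * E.d b m + (u + v) * E.d m c := by
  rw [d_eq ha hc, d_eq hb hc, d_eq ha hm, d_eq hb hm, d_eq hm hc]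
  linear_combination (E.natParam c - E.natParam m) * h

/-- The logarithm of the density of the law with mean `a` with respect to the law with mean `b`. -/
def logLikelihoodRatio (E : ExpFamily) (a b x : ℝ) : ℝ :=
  (E.natParam a - E.natParam b) * x
    - (E.logPartition (E.natParam a) - E.logPartition (E.natParam b))

theorem integrable_logLikelihoodRatio {a : ℝ} (ha : a ∈ E.means) (b : ℝ) :
    Integrable (E.logLikelihoodRatio a b) (E.law a) :=
  ((integrable_id_law ha).const_mul _).sub (integrable_const _)

theorem integral_logLikelihoodRatio {a b : ℝ} (ha : a ∈ E.means) (hb : b ∈ E.means) :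
    ∫ x, E.logLikelihoodRatio a b x ∂(E.law a) = E.d a b := by
  unfold logLikelihoodRatio
  rw [integral_sub ((integrable_id_law ha).const_mul _) (integrable_const _), integral_const_mul,
    integral_id_law ha, d_eq ha hb]
  simp

theorem measurable_logLikelihoodRatio (a b : ℝ) : Measurable (E.logLikelihoodRatio a b) := by
  unfold logLikelihoodRatio; fun_prop

theorem law_apply_eq_lintegral {a b : ℝ} (ha : a ∈ E.means) (hb : b ∈ E.means) {s : Set ℝ}
    (hs : MeasurableSet s) :
    E.law b s = ∫⁻ x in s, ENNReal.ofReal (Real.exp (-E.logLikelihoodRatio a b x)) ∂(E.law a) := by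
  have hθ := natParam_mem ha
  have hη := natParam_mem hb
  rw [law_eq ha, law_eq hb, natLaw_eq_tilted (θ := E.natParam b) hθ, tilted_apply' _ _ hs]
  refine lintegral_congr fun x => ?_
  have := isProbabilityMeasure_natLaw hθ
  rw [← Real.exp_log (integral_exp_pos (integrable_exp_sub_mul hη hθ)),
    log_integral_exp_sub_mul hη hθ,
    ← Real.exp_sub, logLikelihoodRatio]
  congr 2; ring

end ExpFamily
end

/-! ### The deviation function, its inverse, and the equilibrium equation. -/

noncomputable section

section Deviation

open ExpFamily Filter Topology

variable {E : ExpFamily} {K : ℕ} {μ : Fin K → ℝ} {j k : Fin K}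

theorem one_add_mul_mixedMean (μ : Fin K → ℝ) (j k : Fin K) {x : ℝ} (hx : 0 ≤ x) :
    (1 + x) * mixedMean μ j k x = μ k + x * μ j := by
  unfold mixedMean
  field_simp

theorem mixedMean_zero (μ : Fin K → ℝ) (j k : Fin K) : mixedMean μ j k 0 = μ k := by
  simp [mixedMean]

theorem le_mixedMean (hjk : μ k < μ j) {x : ℝ} (hx : 0 ≤ x) : μ k ≤ mixedMean μ j k x := by
  rw [mixedMean, le_div_iff₀ (by linarith)]
  nlinarith

theorem mixedMean_lt (hjk : μ k < μ j) {x : ℝ} (hx : 0 ≤ x) : mixedMean μ j k x < μ j := by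
  rw [mixedMean, div_lt_iff₀ (by linarith)]
  nlinarith

theorem mixedMean_mem_means (hμ : ∀ i, μ i ∈ E.means) (hjk : μ k < μ j) {x : ℝ} (hx : 0 ≤ x) :
    mixedMean μ j k x ∈ E.means :=
  ordConnected_means.out (hμ k) (hμ j) ⟨le_mixedMean hjk hx, (mixedMean_lt hjk hx).le⟩

theorem strictMonoOn_mixedMean (hjk : μ k < μ j) : StrictMonoOn (mixedMean μ j k) (Set.Ici 0) := by
  intro x hx y hy hxy
  rw [Set.mem_Ici] at hx hy
  unfold mixedMean
  rw [div_lt_div_iff₀ (by linarith) (by linarith)]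
  nlinarith [mul_pos (sub_pos.2 hjk) (sub_pos.2 hxy)]

theorem continuousOn_mixedMean (μ : Fin K → ℝ) (j k : Fin K) :
    ContinuousOn (mixedMean μ j k) (Set.Ici 0) := by
  unfold mixedMean
  refine ContinuousOn.div (by fun_prop) (by fun_prop) fun x hx => ?_
  rw [Set.mem_Ici] at hx
  linarith

theorem tendsto_mixedMean (μ : Fin K → ℝ) (j k : Fin K) :
    Tendsto (mixedMean μ j k) atTop (𝓝 (μ j)) := by
  have h1 : Tendsto (fun x : ℝ => μ j + (μ k - μ j) / (1 + x)) atTop (𝓝 (μ j + 0)) :=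
    tendsto_const_nhds.add
      (tendsto_const_nhds.div_atTop (tendsto_atTop_add_const_left _ _ tendsto_id))
  rw [add_zero] at h1
  refine h1.congr' ?_
  filter_upwards [eventually_ge_atTop 0] with x hx
  unfold mixedMean
  field_simp
  ring

theorem deviation_zero (E : ExpFamily) (μ : Fin K → ℝ) (j k : Fin K) : deviation E μ j k 0 = 0 := by
  simp [deviation, mixedMean_zero, d_self]

/-- `deviation` is thus the minimum over `c` of the left side, attained only at the mixed mean; the
explicit surplus is what proves uniqueness of the optimal proportions. -/
theorem deviation_add (hμ : ∀ i, μ i ∈ E.means) (hjk : μ k < μ j) {x : ℝ} (hx : 0 ≤ x) {c : ℝ}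
    (hc : c ∈ E.means) :
    E.d (μ k) c + x * E.d (μ j) c
      = deviation E μ j k x + (1 + x) * E.d (mixedMean μ j k x) c := by
  have := weighted_d_eq (u := 1) (v := x) (hμ k) (hμ j) (mixedMean_mem_means hμ hjk hx) hc
    (by rw [one_add_mul_mixedMean μ j k hx]; ring)
  rw [deviation]
  linarith

theorem deviation_le (hμ : ∀ i, μ i ∈ E.means) (hjk : μ k < μ j) {x : ℝ} (hx : 0 ≤ x) {c : ℝ}
    (hc : c ∈ E.means) : deviation E μ j k x ≤ E.d (μ k) c + x * E.d (μ j) c := by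
  rw [deviation_add hμ hjk hx hc]
  have := d_nonneg (E := E) (mixedMean μ j k x) c
  have : 0 ≤ (1 + x) * E.d (mixedMean μ j k x) c := by positivity
  linarith

theorem d_mixedMean_pos (hμ : ∀ i, μ i ∈ E.means) (hjk : μ k < μ j) {x : ℝ} (hx : 0 ≤ x) :
    0 < E.d (μ j) (mixedMean μ j k x) :=
  d_pos (hμ j) (mixedMean_mem_means hμ hjk hx) (mixedMean_lt hjk hx).ne'

/-- A minimum of functions increasing in the weight: evaluate the cost with weight `x` at the
minimizer for `y`, then raise the weight to `y`. -/
theorem strictMonoOn_deviation (hμ : ∀ i, μ i ∈ E.means) (hjk : μ k < μ j) :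
    StrictMonoOn (deviation E μ j k) (Set.Ici 0) := by
  intro x hx y hy hxy
  refine (deviation_le hμ hjk hx (mixedMean_mem_means hμ hjk hy)).trans_lt ?_
  rw [deviation]
  have := d_mixedMean_pos hμ hjk hy
  gcongr

theorem continuousOn_d_mixedMean (hμ : ∀ i, μ i ∈ E.means) (hjk : μ k < μ j) (i : Fin K) :
    ContinuousOn (fun x => E.d (μ i) (mixedMean μ j k x)) (Set.Ici 0) :=
  ContinuousOn.comp (g := E.d (μ i)) (t := E.means)
    (fun _ hb => (continuousAt_d_right (hμ i) hb).continuousWithinAt)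
    (continuousOn_mixedMean μ j k) fun _ hx => mixedMean_mem_means hμ hjk hx

theorem continuousOn_deviation (hμ : ∀ i, μ i ∈ E.means) (hjk : μ k < μ j) :
    ContinuousOn (deviation E μ j k) (Set.Ici 0) :=
  (continuousOn_d_mixedMean hμ hjk k).add
    (continuousOn_id.mul (continuousOn_d_mixedMean hμ hjk j))

theorem deviation_lt_d (hμ : ∀ i, μ i ∈ E.means) (hjk : μ k < μ j) {x : ℝ} (hx : 0 ≤ x) :
    deviation E μ j k x < E.d (μ k) (μ j) := by
  have h1 : deviation E μ j k x < deviation E μ j k (x + 1) :=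
    strictMonoOn_deviation hμ hjk hx (Set.mem_Ici.2 (by linarith)) (by linarith)
  have h2 := deviation_le hμ hjk (x := x + 1) (by linarith) (hμ j)
  rw [d_self] at h2
  linarith

theorem tendsto_d_mixedMean (hμ : ∀ i, μ i ∈ E.means) (i j k : Fin K) :
    Tendsto (fun x => E.d (μ i) (mixedMean μ j k x)) atTop (𝓝 (E.d (μ i) (μ j))) :=
  (continuousAt_d_right (hμ i) (hμ j)).tendsto.comp (tendsto_mixedMean μ j k)

theorem image_deviation (hμ : ∀ i, μ i ∈ E.means) (hjk : μ k < μ j) :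
    deviation E μ j k '' Set.Ici 0 = Set.Ico 0 (E.d (μ k) (μ j)) := by
  apply Set.Subset.antisymm
  · rintro _ ⟨x, hx, rfl⟩
    refine ⟨?_, deviation_lt_d hμ hjk hx⟩
    rw [← deviation_zero E μ j k]
    exact (strictMonoOn_deviation hμ hjk).monotoneOn Set.self_mem_Ici hx hx
  · rintro y ⟨hy0, hy⟩
    -- The first summand alone tends to `d (μ k) (μ j)`, so the limit of the summand `x * d` is not
    -- needed.
    obtain ⟨x, hxy, hx⟩ := (((tendsto_d_mixedMean hμ k j k).eventually (lt_mem_nhds hy)).and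
      (eventually_ge_atTop 0)).exists
    have hle : y ≤ deviation E μ j k x := by
      have := mul_nonneg hx (d_mixedMean_pos hμ hjk hx).le
      rw [deviation]
      linarith
    obtain ⟨t, ht, rfl⟩ := intermediate_value_Icc hx
      ((continuousOn_deviation hμ hjk).mono Set.Icc_subset_Ici_self)
      ⟨(deviation_zero E μ j k).trans_le hy0, hle⟩
    exact ⟨t, ht.1, rfl⟩

theorem deviationInv_self (E : ExpFamily) (μ : Fin K → ℝ) (k : Fin K) (y : ℝ) :
    deviationInv E μ k k y = 1 := by
  simp [deviationInv]

theorem deviationInv_nonneg (hμ : ∀ i, μ i ∈ E.means) (hjk : μ k < μ j) {y : ℝ}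
    (hy : y ∈ Set.Ico 0 (E.d (μ k) (μ j))) : 0 ≤ deviationInv E μ j k y := by
  rw [← image_deviation hμ hjk] at hy
  rw [deviationInv, if_neg (by rintro rfl; exact hjk.false)]
  exact Function.invFunOn_mem hy

theorem deviation_deviationInv (hμ : ∀ i, μ i ∈ E.means) (hjk : μ k < μ j) {y : ℝ}
    (hy : y ∈ Set.Ico 0 (E.d (μ k) (μ j))) : deviation E μ j k (deviationInv E μ j k y) = y := by
  rw [← image_deviation hμ hjk] at hy
  rw [deviationInv, if_neg (by rintro rfl; exact hjk.false)]
  exact Function.invFunOn_eq hy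

theorem deviationInv_deviation (hμ : ∀ i, μ i ∈ E.means) (hjk : μ k < μ j) {x : ℝ} (hx : 0 ≤ x) :
    deviationInv E μ j k (deviation E μ j k x) = x := by
  have hmem : deviation E μ j k x ∈ Set.Ico 0 (E.d (μ k) (μ j)) := by
    rw [← image_deviation hμ hjk]; exact ⟨x, hx, rfl⟩
  exact (strictMonoOn_deviation hμ hjk).injOn (deviationInv_nonneg hμ hjk hmem) hx
    (deviation_deviationInv hμ hjk hmem)

theorem deviationInv_zero (hμ : ∀ i, μ i ∈ E.means) (hjk : μ k < μ j) :
    deviationInv E μ j k 0 = 0 := by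
  conv_lhs => rw [← deviation_zero E μ j k]
  exact deviationInv_deviation hμ hjk le_rfl

theorem strictMonoOn_deviationInv (hμ : ∀ i, μ i ∈ E.means) (hjk : μ k < μ j) :
    StrictMonoOn (deviationInv E μ j k) (Set.Ico 0 (E.d (μ k) (μ j))) := by
  intro y hy z hz hyz
  rwa [← (strictMonoOn_deviation hμ hjk).lt_iff_lt (deviationInv_nonneg hμ hjk hy)
    (deviationInv_nonneg hμ hjk hz), deviation_deviationInv hμ hjk hy,
    deviation_deviationInv hμ hjk hz]

theorem image_deviationInv (hμ : ∀ i, μ i ∈ E.means) (hjk : μ k < μ j) :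
    deviationInv E μ j k '' Set.Ico 0 (E.d (μ k) (μ j)) = Set.Ici 0 := by
  apply Set.Subset.antisymm
  · rintro _ ⟨y, hy, rfl⟩
    exact deviationInv_nonneg hμ hjk hy
  · intro x hx
    refine ⟨deviation E μ j k x, ?_, deviationInv_deviation hμ hjk hx⟩
    rw [← image_deviation hμ hjk]
    exact ⟨x, hx, rfl⟩

/-- A strictly monotone map whose image is an interval is continuous; at the endpoint `0` the
one-sided form of this fact is used. -/
theorem continuousOn_deviationInv (hμ : ∀ i, μ i ∈ E.means) (hjk : μ k < μ j) :
    ContinuousOn (deviationInv E μ j k) (Set.Ico 0 (E.d (μ k) (μ j))) := by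
  have hmono := strictMonoOn_deviationInv hμ hjk
  intro y hy
  rcases hy.1.eq_or_lt with rfl | hy0
  · refine ContinuousWithinAt.mono ?_ Set.Ico_subset_Ici_self
    refine hmono.continuousWithinAt_right_of_image_mem_nhdsWithin (Ico_mem_nhdsGE hy.2) ?_
    rw [image_deviationInv hμ hjk, deviationInv_zero hμ hjk]
    exact self_mem_nhdsWithin
  · refine (hmono.continuousAt_of_image_mem_nhds (Ico_mem_nhds hy0 hy.2) ?_).continuousWithinAt
    rw [image_deviationInv hμ hjk]
    refine Ici_mem_nhds ?_
    rw [← deviationInv_zero hμ hjk]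
    exact hmono ⟨le_rfl, hy0.trans hy.2⟩ hy hy0

/-- As `x` grows the mixed mean moves away from `μ k` and towards `μ j`, so the numerator grows and
the denominator shrinks. -/
theorem strictMonoOn_equilibrium_term (hμ : ∀ i, μ i ∈ E.means) (hjk : μ k < μ j) :
    StrictMonoOn (fun x => E.d (μ k) (mixedMean μ j k x) / E.d (μ j) (mixedMean μ j k x))
      (Set.Ici 0) := by
  intro x hx y hy hxy
  rw [Set.mem_Ici] at hx hy
  have hm := strictMonoOn_mixedMean hjk hx hy hxy
  have hxm := mixedMean_mem_means hμ hjk hx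
  have hym := mixedMean_mem_means hμ hjk hy
  have h1 := d_lt_d_of_le_of_lt (hμ k) hxm hym (le_mixedMean hjk hx) hm
  have h2 := d_lt_d_of_lt_of_le (hμ j) hym hxm hm (mixedMean_lt hjk hy).le
  exact div_lt_div₀ h1 h2.le (d_nonneg _ _) (d_mixedMean_pos hμ hjk hy)

theorem mem_moreLoaded : j ∈ moreLoaded μ k ↔ μ k < μ j := by simp [moreLoaded]

/-- Intermediate value theorem on `[0, y]`. The slice `i` minimizing `d (μ k) (μ j)` has the
shortest range of levels, so all inverses are defined up to any level it reaches; near the end of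
that range its own ratio exceeds `1`. -/
theorem exists_equilibrium (hμ : ∀ i, μ i ∈ E.means) (hne : (moreLoaded μ k).Nonempty) :
    ∃ y, IsEquilibrium E μ k (moreLoaded μ k) y := by
  set S := moreLoaded μ k
  obtain ⟨i, hi, hmin⟩ := S.exists_min_image (fun j => E.d (μ k) (μ j)) hne
  have hik := mem_moreLoaded.1 hi
  have hD := d_pos (hμ k) (hμ i) hik.ne
  have hsmall : ∀ᶠ x in atTop, E.d (μ i) (mixedMean μ i k x) < E.d (μ k) (μ i) / 2 := by
    have h := tendsto_d_mixedMean hμ i i k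
    rw [d_self] at h
    exact h.eventually (gt_mem_nhds (half_pos hD))
  -- Numerator above and denominator below half of `d (μ k) (μ i)`: the term of `i` is at least `1`.
  obtain ⟨x, ⟨hx1, hx2⟩, hx⟩ := (((tendsto_d_mixedMean hμ k i k).eventually
    (lt_mem_nhds (half_lt_self hD))).and hsmall).and (eventually_ge_atTop (0 : ℝ)) |>.exists
  set y := deviation E μ i k x with hy
  have hyI : y ∈ Set.Ico 0 (E.d (μ k) (μ i)) := by
    rw [← image_deviation hμ hik]; exact ⟨x, hx, rfl⟩
  have hsub : ∀ j ∈ S, Set.Icc 0 y ⊆ Set.Ico 0 (E.d (μ k) (μ j)) := fun j hj t ht =>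
    ⟨ht.1, ht.2.trans_lt (hyI.2.trans_le (hmin j hj))⟩
  have hcont : ContinuousOn (equilibrium E μ k S) (Set.Icc 0 y) := by
    refine continuousOn_finsetSum _ fun j hj => ?_
    have hjk := mem_moreLoaded.1 hj
    have hc := (continuousOn_deviationInv hμ hjk).mono (hsub j hj)
    have hmaps : Set.MapsTo (deviationInv E μ j k) (Set.Icc 0 y) (Set.Ici 0) := fun t ht =>
      deviationInv_nonneg hμ hjk (hsub j hj ht)
    exact ((continuousOn_d_mixedMean hμ hjk k).comp hc hmaps).div
      ((continuousOn_d_mixedMean hμ hjk j).comp hc hmaps)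
      fun t ht => (d_mixedMean_pos hμ hjk (hmaps ht)).ne'
  have h0 : equilibrium E μ k S 0 ≤ 1 := by
    refine (Finset.sum_eq_zero fun j hj => ?_).trans_le zero_le_one
    rw [deviationInv_zero hμ (mem_moreLoaded.1 hj), mixedMean_zero, d_self, zero_div]
  have h1 : 1 ≤ equilibrium E μ k S y := by
    refine le_trans ?_ (Finset.single_le_sum (fun j _ => div_nonneg (d_nonneg _ _)
      (d_nonneg _ _)) hi)
    rw [hy, deviationInv_deviation hμ hik hx, one_le_div (d_mixedMean_pos hμ hik hx)]
    linarith
  obtain ⟨t, ht, hty⟩ := intermediate_value_Icc hyI.1 hcont ⟨h0, h1⟩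
  refine ⟨t, fun j hj => ?_, hty⟩
  rw [image_deviation hμ (mem_moreLoaded.1 hj)]
  exact hsub j hj ht

theorem equilibrium_lt (hμ : ∀ i, μ i ∈ E.means) (hne : (moreLoaded μ k).Nonempty) {y z : ℝ}
    (hy : ∀ j ∈ moreLoaded μ k, y ∈ Set.Ico 0 (E.d (μ k) (μ j)))
    (hz : ∀ j ∈ moreLoaded μ k, z ∈ Set.Ico 0 (E.d (μ k) (μ j))) (hyz : y < z) :
    equilibrium E μ k (moreLoaded μ k) y < equilibrium E μ k (moreLoaded μ k) z := by
  refine Finset.sum_lt_sum_of_nonempty hne fun j hj => ?_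
  have hjk := mem_moreLoaded.1 hj
  exact strictMonoOn_equilibrium_term hμ hjk (deviationInv_nonneg hμ hjk (hy j hj))
    (deviationInv_nonneg hμ hjk (hz j hj))
    (strictMonoOn_deviationInv hμ hjk (hy j hj) (hz j hj) hyz)

theorem IsEquilibrium.mem_Ico (hμ : ∀ i, μ i ∈ E.means) {y : ℝ}
    (hy : IsEquilibrium E μ k (moreLoaded μ k) y) (hj : μ k < μ j) :
    y ∈ Set.Ico 0 (E.d (μ k) (μ j)) := by
  rw [← image_deviation hμ hj]
  exact hy.1 j (mem_moreLoaded.2 hj)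

theorem existsUnique_equilibrium (hμ : ∀ i, μ i ∈ E.means) (hne : (moreLoaded μ k).Nonempty) :
    ∃! y, IsEquilibrium E μ k (moreLoaded μ k) y := by
  obtain ⟨y, hy⟩ := exists_equilibrium hμ hne
  refine ⟨y, hy, fun z hz => ?_⟩
  have hyI := fun j hj => hy.mem_Ico hμ (j := j) (mem_moreLoaded.1 hj)
  have hzI := fun j hj => hz.mem_Ico hμ (j := j) (mem_moreLoaded.1 hj)
  rcases lt_trichotomy z y with h | h | h
  · exact absurd (equilibrium_lt hμ hne hzI hyI h) (by rw [hy.2, hz.2]; exact lt_irrefl _)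
  · exact h
  · exact absurd (equilibrium_lt hμ hne hyI hzI h) (by rw [hy.2, hz.2]; exact lt_irrefl _)

theorem IsEquilibrium.pos (hμ : ∀ i, μ i ∈ E.means) (hne : (moreLoaded μ k).Nonempty) {y : ℝ}
    (hy : IsEquilibrium E μ k (moreLoaded μ k) y) : 0 < y := by
  obtain ⟨i, hi⟩ := hne
  refine lt_of_le_of_ne (hy.mem_Ico hμ (mem_moreLoaded.1 hi)).1 ?_
  rintro rfl
  have h := hy.2
  rw [equilibrium, Finset.sum_eq_zero fun j hj => by
    rw [deviationInv_zero hμ (mem_moreLoaded.1 hj), mixedMean_zero, d_self, zero_div]] at h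
  exact zero_ne_one h

end Deviation
end

/-! ### The max-min problem: boundary alternatives, multipliers, and the unique maximizer. -/

noncomputable section

section Duality

open ExpFamily Filter Topology

variable {E : ExpFamily} {K : ℕ} {γ : ℝ} {μ : Fin K → ℝ} {k₀ : Fin K}

/-- Such a vector may have tied minima or minimum `γ`, hence lie outside `loadModels`. Raise the
load of `k₀` by `2 * s`, then lower one minimal load by at most `s`: the minimizer becomes unique,
and `k₀` keeps a net gain of at least `s`, so it stays a wrong answer. -/
theorem mem_closure_alternatives {l : Fin K → ℝ} (hl : ∀ k, l k ∈ E.means)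
    (h : γ ≤ l k₀ ∨ ∃ j, j ≠ k₀ ∧ l j ≤ l k₀) : l ∈ closure (alternatives E K γ (some k₀)) := by
  rw [Metric.mem_closure_iff]
  intro ε hε
  have hopen : IsOpen (Set.univ.pi fun _ : Fin K => E.means) :=
    isOpen_set_pi Set.finite_univ fun _ _ => isOpen_means
  obtain ⟨r, hr, hball⟩ := Metric.isOpen_iff.1 hopen l fun k _ => hl k
  obtain ⟨s, hs, hsε, hsr⟩ : ∃ s > 0, 3 * s < ε ∧ 3 * s < r := by
    refine ⟨min ε r / 4, by positivity, ?_, ?_⟩ <;> have := lt_min hε hr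
    · have := min_le_left ε r; linarith
    · have := min_le_right ε r; linarith
  have : Nonempty (Fin K) := ⟨k₀⟩
  set l₁ := Function.update l k₀ (l k₀ + 2 * s) with hl₁
  obtain ⟨i, hi⟩ := Finite.exists_min l₁
  -- Of the two drops `s` and `s / 2` at least one keeps the new minimum different from `γ`.
  obtain ⟨η, hη, hηs, hηγ⟩ : ∃ η > 0, η ≤ s ∧ l₁ i - η ≠ γ := by
    by_cases hc : l₁ i - s = γ
    · exact ⟨s / 2, by linarith, by linarith, by intro h'; linarith⟩
    · exact ⟨s, hs, le_rfl, hc⟩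
  have hl₁k : l₁ k₀ = l k₀ + 2 * s := by simp [hl₁]
  have hl₁j : ∀ j, j ≠ k₀ → l₁ j = l j := fun j hj => by simp [hl₁, hj]
  set l₂ := Function.update l₁ i (l₁ i - η) with hl₂
  have hl₂i : l₂ i = l₁ i - η := by simp [hl₂]
  have hl₂j : ∀ j, j ≠ i → l₂ j = l₁ j := fun j hj => by simp [hl₂, hj]
  have hl₂le : ∀ j, l₂ j ≤ l₁ j := fun j => by
    by_cases hj : j = i
    · subst hj; linarith
    · exact (hl₂j j hj).le
  have hl₂ge : ∀ j, l₁ j - s ≤ l₂ j := fun j => by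
    by_cases hj : j = i
    · subst hj; linarith
    · rw [hl₂j j hj]; linarith
  have hdist : dist l l₂ ≤ 2 * s := by
    refine (dist_pi_le_iff (by positivity)).2 fun j => ?_
    have h1 := hl₂le j
    have h2 := hl₂ge j
    rw [Real.dist_eq, abs_le]
    by_cases hj : j = k₀
    · subst hj; constructor <;> linarith
    · rw [hl₁j j hj] at h1 h2; constructor <;> linarith
  have hmin : ∀ j, j ≠ i → l₂ i < l₂ j := fun j hj => by
    rw [hl₂i, hl₂j j hj]; have := hi j; linarith
  have hmin' : ∀ k, (∀ j, l₂ k ≤ l₂ j) → k = i := fun k hk => by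
    by_contra hki
    exact absurd (hk i) (not_le.2 (hmin k hki))
  refine ⟨l₂, ⟨⟨fun k => ?_, ⟨i, fun j => ?_, hmin'⟩, fun k hk => ?_⟩, ?_⟩, by linarith⟩
  · exact hball (by rw [Metric.mem_ball, dist_comm]; linarith) k (Set.mem_univ k)
  · by_cases hj : j = i
    · rw [hj]
    · exact (hmin j hj).le
  · rw [hmin' k hk, hl₂i]; exact hηγ
  · rintro ⟨hlt, hle⟩
    have h2 := hl₂ge k₀
    rcases h with h | ⟨j, hjk, hj⟩
    · linarith
    · have h3 := hl₂le j
      rw [hl₁j j hjk] at h3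
      have := hle j
      linarith

theorem le_sum_of_mem_closure_alternatives (hμ : ∀ k, μ k ∈ E.means) {w : Fin K → ℝ} {r : ℝ}
    {a : Option (Fin K)} (hr : ∀ l ∈ alternatives E K γ a, r ≤ ∑ k, w k * E.d (μ k) (l k))
    {l : Fin K → ℝ} (hl : ∀ k, l k ∈ E.means) (hmem : l ∈ closure (alternatives E K γ a)) :
    r ≤ ∑ k, w k * E.d (μ k) (l k) := by
  obtain ⟨u, hu, hlim⟩ := mem_closure_iff_seq_limit.1 hmem
  refine ge_of_tendsto' (x := atTop) (f := fun n => ∑ k, w k * E.d (μ k) (u n k)) ?_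
    fun n => hr _ (hu n)
  refine tendsto_finsetSum _ fun k _ => Tendsto.const_mul _ ?_
  exact (continuousAt_d_right (hμ k) (hl k)).tendsto.comp ((tendsto_pi_nhds.1 hlim) k)

/-- Test vector: only the load of `k₀` is changed, to `γ`. -/
theorem le_weight_mul_threshold (hμ : ∀ k, μ k ∈ E.means) (hγ : γ ∈ E.means) {w : Fin K → ℝ}
    {r : ℝ} (hr : ∀ l ∈ alternatives E K γ (some k₀), r ≤ ∑ k, w k * E.d (μ k) (l k)) :
    r ≤ w k₀ * E.d (μ k₀) γ := by
  have hl : ∀ k, Function.update μ k₀ γ k ∈ E.means := fun k => by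
    by_cases hk : k = k₀
    · subst hk; simpa using hγ
    · simpa [hk] using hμ k
  have h := le_sum_of_mem_closure_alternatives hμ hr hl
    (mem_closure_alternatives hl (Or.inl (by simp)))
  rwa [Finset.sum_eq_single_of_mem k₀ (Finset.mem_univ _) fun k _ hk => by simp [hk, d_self],
    Function.update_self] at h

/-- Test vector: the loads of `k₀` and `j` are both replaced by `c`. -/
theorem le_weight_mul_common (hμ : ∀ k, μ k ∈ E.means) {w : Fin K → ℝ} {r : ℝ}
    (hr : ∀ l ∈ alternatives E K γ (some k₀), r ≤ ∑ k, w k * E.d (μ k) (l k)) {j : Fin K}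
    (hj : j ≠ k₀) {c : ℝ} (hc : c ∈ E.means) :
    r ≤ w k₀ * E.d (μ k₀) c + w j * E.d (μ j) c := by
  have hl : ∀ k, (if k = k₀ ∨ k = j then c else μ k) ∈ E.means := fun k => by
    split_ifs
    · exact hc
    · exact hμ k
  have h := le_sum_of_mem_closure_alternatives hμ hr hl
    (mem_closure_alternatives hl (Or.inr ⟨j, hj, by simp⟩))
  rw [← Finset.sum_subset (Finset.subset_univ {k₀, j}) fun k _ hk => ?_,
    Finset.sum_pair hj.symm] at h
  · simpa using h
  · simp only [Finset.mem_insert, Finset.mem_singleton] at hk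
    simp [hk, d_self]

theorem moreLoaded_eq_erase (hmin : ∀ j, j ≠ k₀ → μ k₀ < μ j) :
    moreLoaded μ k₀ = Finset.univ.erase k₀ := by
  ext j
  simp only [mem_moreLoaded, Finset.mem_erase, Finset.mem_univ, and_true]
  exact ⟨fun h => by rintro rfl; exact h.false, hmin j⟩

theorem sum_eq_add_sum_moreLoaded (hmin : ∀ j, j ≠ k₀ → μ k₀ < μ j) (f : Fin K → ℝ) :
    ∑ k, f k = f k₀ + ∑ j ∈ moreLoaded μ k₀, f j := by
  rw [moreLoaded_eq_erase hmin, Finset.add_sum_erase _ _ (Finset.mem_univ _)]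

/-- Lagrange multipliers: the constraints at the threshold and at the points `mixedMean` add up
to `r * T ≤ ∑ k, w k`, strictly so if one of the constraints is strict. -/
theorem mul_characteristicTime_le (hμ : ∀ k, μ k ∈ E.means) (hmin : ∀ j, j ≠ k₀ → μ k₀ < μ j)
    {y z : ℝ} (hz : 0 < z) (hzI : ∀ j, j ≠ k₀ → z ∈ Set.Ico 0 (E.d (μ k₀) (μ j)))
    (hF : equilibrium E μ k₀ (moreLoaded μ k₀) z ≤ 1)
    (hFz : equilibrium E μ k₀ (moreLoaded μ k₀) z < 1 → z = y) {w : Fin K → ℝ} {r : ℝ}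
    (h0 : r ≤ w k₀ * y)
    (hr : ∀ j, j ≠ k₀ → r ≤ w k₀ * E.d (μ k₀) (mixedMean μ j k₀ (deviationInv E μ j k₀ z))
      + w j * E.d (μ j) (mixedMean μ j k₀ (deviationInv E μ j k₀ z))) :
    r * characteristicTime E μ k₀ z ≤ ∑ k, w k ∧
    ((∃ j, j ≠ k₀ ∧ r < w k₀ * E.d (μ k₀) (mixedMean μ j k₀ (deviationInv E μ j k₀ z))
      + w j * E.d (μ j) (mixedMean μ j k₀ (deviationInv E μ j k₀ z))) →
      r * characteristicTime E μ k₀ z < ∑ k, w k) := by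
  set S := moreLoaded μ k₀ with hS
  have hSne : ∀ j ∈ S, j ≠ k₀ := fun j hj => by
    rintro rfl; exact (mem_moreLoaded.1 hj).false
  set x : Fin K → ℝ := fun j => deviationInv E μ j k₀ z with hx
  set A : Fin K → ℝ := fun j => E.d (μ k₀) (mixedMean μ j k₀ (x j)) with hA
  set B : Fin K → ℝ := fun j => E.d (μ j) (mixedMean μ j k₀ (x j)) with hB
  have hx0 : ∀ j ∈ S, 0 ≤ x j := fun j hj =>
    deviationInv_nonneg hμ (hmin j (hSne j hj)) (hzI j (hSne j hj))
  have hBpos : ∀ j ∈ S, 0 < B j := fun j hj =>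
    d_mixedMean_pos hμ (hmin j (hSne j hj)) (hx0 j hj)
  have hzAB : ∀ j ∈ S, A j + x j * B j = z := fun j hj =>
    deviation_deviationInv hμ (hmin j (hSne j hj)) (hzI j (hSne j hj))
  have hFeq : equilibrium E μ k₀ S z = ∑ j ∈ S, A j / B j := rfl
  set F := equilibrium E μ k₀ S z with hFdef
  -- Divide `A j + x j * B j = z` by `B j` and sum over `S`.
  have hsumx : F + ∑ j ∈ S, x j = z * ∑ j ∈ S, 1 / B j := by
    rw [hFeq, ← Finset.sum_add_distrib, Finset.mul_sum]
    refine Finset.sum_congr rfl fun j hj => ?_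
    have := (hBpos j hj).ne'
    rw [← hzAB j hj]
    field_simp
  have hT : r * characteristicTime E μ k₀ z = r * (1 - F) / z + ∑ j ∈ S, r * (1 / B j) := by
    rw [characteristicTime, sum_eq_add_sum_moreLoaded hmin, deviationInv_self, ← Finset.mul_sum]
    have : ∑ j ∈ S, x j = z * ∑ j ∈ S, 1 / B j - F := by linarith
    rw [this]
    field_simp
    ring
  have hW : ∑ k, w k = w k₀ * (1 - F) + ∑ j ∈ S, (w k₀ * (A j / B j) + w j) := by
    rw [sum_eq_add_sum_moreLoaded hmin, Finset.sum_add_distrib, ← Finset.mul_sum, ← hFeq]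
    ring
  -- Complementary slackness: the multiplier `(1 - F) / z` vanishes, or `z` equals the threshold
  -- divergence `y`.
  have hfirst : r * (1 - F) / z ≤ w k₀ * (1 - F) := by
    rcases hF.eq_or_lt with h | h
    · simp [h]
    · rw [← hFz h] at h0
      rw [div_le_iff₀ hz]
      nlinarith
  have hterm : ∀ j ∈ S, w k₀ * (A j / B j) + w j = (w k₀ * A j + w j * B j) * (1 / B j) := by
    intro j hj
    have := (hBpos j hj).ne'
    field_simp
  have hle : ∀ j ∈ S, r * (1 / B j) ≤ w k₀ * (A j / B j) + w j := fun j hj => by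
    rw [hterm j hj]
    exact mul_le_mul_of_nonneg_right (hr j (hSne j hj)) (one_div_pos.2 (hBpos j hj)).le
  rw [hT, hW]
  refine ⟨add_le_add hfirst (Finset.sum_le_sum hle), ?_⟩
  rintro ⟨j, hj, hlt⟩
  have hjS : j ∈ S := mem_moreLoaded.2 (hmin j hj)
  refine add_lt_add_of_le_of_lt hfirst (Finset.sum_lt_sum hle ⟨j, hjS, ?_⟩)
  rw [hterm j hjS]
  exact mul_lt_mul_of_pos_right hlt (one_div_pos.2 (hBpos j hjS))

/-- If the load of `k₀` reaches `γ`, its own term suffices. Otherwise some `l j < l k₀`, and moving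
both to a suitable common mean does not increase the cost, which is then at least `deviation` at
`deviationInv`, that is, `z`. -/
theorem le_of_mem_alternatives (hμ : ∀ k, μ k ∈ E.means) (hγ : γ ∈ E.means)
    (hmin : ∀ j, j ≠ k₀ → μ k₀ < μ j) (hav : μ k₀ < γ) {z : ℝ} (hzγ : z ≤ E.d (μ k₀) γ)
    (hzI : ∀ j, j ≠ k₀ → z ∈ Set.Ico 0 (E.d (μ k₀) (μ j))) {l : Fin K → ℝ}
    (hl : l ∈ alternatives E K γ (some k₀)) :
    z ≤ ∑ k, deviationInv E μ k k₀ z * E.d (μ k) (l k) := by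
  have hx0 : ∀ j, j ≠ k₀ → 0 ≤ deviationInv E μ j k₀ z := fun j hj =>
    deviationInv_nonneg hμ (hmin j hj) (hzI j hj)
  have hnn : ∀ k, 0 ≤ deviationInv E μ k k₀ z * E.d (μ k) (l k) := fun k => by
    refine mul_nonneg ?_ (d_nonneg _ _)
    by_cases hk : k = k₀
    · rw [hk, deviationInv_self]; exact zero_le_one
    · exact hx0 k hk
  have hlm := hl.1.1
  by_cases hc : γ ≤ l k₀
  · calc z ≤ E.d (μ k₀) γ := hzγ
      _ ≤ E.d (μ k₀) (l k₀) := d_le_d_of_le_of_le (hμ _) hγ (hlm _) hav.le hc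
      _ = deviationInv E μ k₀ k₀ z * E.d (μ k₀) (l k₀) := by rw [deviationInv_self, one_mul]
      _ ≤ _ := Finset.single_le_sum (fun k _ => hnn k) (Finset.mem_univ k₀)
  · obtain ⟨j, hj⟩ : ∃ j, l j < l k₀ := by
      by_contra! hcon
      exact hl.2 ⟨not_le.1 hc, hcon⟩
    have hjk : j ≠ k₀ := by rintro rfl; exact hj.false
    have hsum : E.d (μ k₀) (l k₀) + deviationInv E μ j k₀ z * E.d (μ j) (l j)
        ≤ ∑ k, deviationInv E μ k k₀ z * E.d (μ k) (l k) := by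
      refine le_trans (le_of_eq ?_) (Finset.sum_le_sum_of_subset_of_nonneg
        (Finset.subset_univ {k₀, j}) fun k _ _ => hnn k)
      rw [Finset.sum_pair hjk.symm, deviationInv_self, one_mul]
    refine le_trans ?_ hsum
    have hdev : ∀ c ∈ E.means, z ≤ E.d (μ k₀) c + deviationInv E μ j k₀ z * E.d (μ j) c :=
      fun c hc => by
        conv_lhs => rw [← deviation_deviationInv hμ (hmin j hjk) (hzI j hjk)]
        exact deviation_le hμ (hmin j hjk) (hx0 j hjk) hc
    -- The common mean is the smaller of `l k₀` and `μ j`.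
    rcases le_total (l k₀) (μ j) with h | h
    · refine (hdev _ (hlm k₀)).trans (add_le_add le_rfl ?_)
      exact mul_le_mul_of_nonneg_left (d_le_d_of_ge_of_ge (hμ j) (hlm _) (hlm _) hj.le h)
        (hx0 j hjk)
    · refine (hdev _ (hμ j)).trans (add_le_add ?_ ?_)
      · exact d_le_d_of_le_of_le (hμ _) (hμ _) (hlm _) (hmin j hjk).le h
      · rw [d_self, mul_zero]; exact mul_nonneg (hx0 j hjk) (d_nonneg _ _)

/-- The level at which the optimal proportions balance the constraints of the alternatives. -/
structure IsOptimalLevel (E : ExpFamily) {K : ℕ} (γ : ℝ) (μ : Fin K → ℝ) (k₀ : Fin K) (z : ℝ) :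
    Prop where
  mem_means : ∀ k, μ k ∈ E.means
  threshold_mem : γ ∈ E.means
  lt_of_ne : ∀ j, j ≠ k₀ → μ k₀ < μ j
  lt_threshold : μ k₀ < γ
  pos : 0 < z
  le_threshold : z ≤ E.d (μ k₀) γ
  mem_Ico : ∀ j, j ≠ k₀ → z ∈ Set.Ico 0 (E.d (μ k₀) (μ j))
  equilibrium_le : equilibrium E μ k₀ (moreLoaded μ k₀) z ≤ 1
  eq_threshold : equilibrium E μ k₀ (moreLoaded μ k₀) z < 1 → z = E.d (μ k₀) γ

/-- The equilibrium function is increasing and equals `1` at `y`, so it is at most `1` at the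
minimum, and a value below `1` forces the minimum to be the threshold divergence. -/
theorem isOptimalLevel_min (hμ : ∀ k, μ k ∈ E.means) (hγ : γ ∈ E.means)
    (hmin : ∀ j, j ≠ k₀ → μ k₀ < μ j) (hav : μ k₀ < γ) (hne : (moreLoaded μ k₀).Nonempty) {y : ℝ}
    (hy : IsEquilibrium E μ k₀ (moreLoaded μ k₀) y) :
    IsOptimalLevel E γ μ k₀ (min (E.d (μ k₀) γ) y) := by
  have hy0 := hy.pos hμ hne
  have hz0 : 0 < min (E.d (μ k₀) γ) y := lt_min (d_pos (hμ _) hγ hav.ne) hy0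
  have hyI := fun j hj => hy.mem_Ico hμ (hmin j hj)
  have hzI : ∀ j, j ≠ k₀ → min (E.d (μ k₀) γ) y ∈ Set.Ico 0 (E.d (μ k₀) (μ j)) := fun j hj =>
    ⟨hz0.le, (min_le_right _ _).trans_lt (hyI j hj).2⟩
  have hS : ∀ j ∈ moreLoaded μ k₀, j ≠ k₀ := fun j hj => by
    rintro rfl; exact (mem_moreLoaded.1 hj).false
  refine ⟨hμ, hγ, hmin, hav, hz0, min_le_left _ _, hzI, ?_, fun hlt => ?_⟩
  · rcases (min_le_right (E.d (μ k₀) γ) y).eq_or_lt with h | h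
    · rw [h, hy.2]
    · rw [← hy.2]
      exact (equilibrium_lt hμ hne (fun j hj => hzI j (hS j hj)) (fun j hj => hyI j (hS j hj)) h).le
  · refine min_eq_left (le_of_not_gt fun h => ?_)
    rw [min_eq_right h.le, hy.2] at hlt
    exact hlt.false

theorem informationRate_le {w : Fin K → ℝ} (hw : w ∈ stdSimplex ℝ (Fin K)) {l : Fin K → ℝ}
    (hl : l ∈ alternatives E K γ (some k₀)) :
    informationRate E γ μ (some k₀) w ≤ ∑ k, w k * E.d (μ k) (l k) := by
  -- A real infimum is meaningful only when bounded below; here nonnegativity of `w` gives the bound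
  -- `0`.
  refine ciInf_le (f := fun l : alternatives E K γ (some k₀) => ∑ k, w k * E.d (μ k) (l.1 k))
    ⟨0, ?_⟩ ⟨l, hl⟩
  rintro _ ⟨l', rfl⟩
  exact Finset.sum_nonneg fun k _ => mul_nonneg (hw.1 k) (d_nonneg _ _)

namespace IsOptimalLevel

variable {z : ℝ}

theorem deviationInv_nonneg (h : IsOptimalLevel E γ μ k₀ z)
    (k : Fin K) : 0 ≤ deviationInv E μ k k₀ z := by
  by_cases hk : k = k₀
  · rw [hk, deviationInv_self]; exact zero_le_one
  · exact _root_.deviationInv_nonneg h.mem_means (h.lt_of_ne k hk) (h.mem_Ico k hk)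

theorem sum_deviationInv_pos (h : IsOptimalLevel E γ μ k₀ z)
    : 0 < ∑ k, deviationInv E μ k k₀ z := by
  refine Finset.sum_pos' (fun k _ => h.deviationInv_nonneg k) ⟨k₀, Finset.mem_univ _, ?_⟩
  rw [deviationInv_self]; exact zero_lt_one

theorem characteristicTime_pos (h : IsOptimalLevel E γ μ k₀ z) : 0 < characteristicTime E μ k₀ z :=
  mul_pos (one_div_pos.2 h.pos) h.sum_deviationInv_pos

theorem proportions_eq (h : IsOptimalLevel E γ μ k₀ z) (k : Fin K) :
    proportions E μ k₀ z k = deviationInv E μ k k₀ z / ∑ i, deviationInv E μ i k₀ z := by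
  have := h.pos.ne'
  rw [proportions, characteristicTime, ← mul_assoc, mul_one_div_cancel this, one_mul]

theorem proportions_mem_stdSimplex (h : IsOptimalLevel E γ μ k₀ z)
    : proportions E μ k₀ z ∈ stdSimplex ℝ (Fin K) := by
  refine ⟨fun k => ?_, ?_⟩
  · rw [h.proportions_eq]
    exact div_nonneg (h.deviationInv_nonneg k) h.sum_deviationInv_pos.le
  · simp only [h.proportions_eq]
    rw [← Finset.sum_div, div_self h.sum_deviationInv_pos.ne']

/-- No normalization of `w` is required, so the inequality serves both for proportions and for
expected numbers of measurements. -/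
theorem mul_characteristicTime_le_sum (h : IsOptimalLevel E γ μ k₀ z) {w : Fin K → ℝ} {r : ℝ}
    (hr : ∀ l ∈ alternatives E K γ (some k₀), r ≤ ∑ k, w k * E.d (μ k) (l k)) :
    r * characteristicTime E μ k₀ z ≤ ∑ k, w k :=
  (mul_characteristicTime_le h.mem_means h.lt_of_ne h.pos h.mem_Ico h.equilibrium_le h.eq_threshold
    (le_weight_mul_threshold h.mem_means h.threshold_mem hr) fun _ hj =>
      le_weight_mul_common h.mem_means hr hj (mixedMean_mem_means h.mem_means (h.lt_of_ne _ hj)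
        (h.deviationInv_nonneg _))).1

theorem informationRate_proportions (h : IsOptimalLevel E γ μ k₀ z) :
    informationRate E γ μ (some k₀) (proportions E μ k₀ z) = (characteristicTime E μ k₀ z)⁻¹ := by
  have hT := h.characteristicTime_pos
  have hw := h.proportions_mem_stdSimplex
  apply le_antisymm
  · rw [← one_div, le_div_iff₀ hT]
    exact (h.mul_characteristicTime_le_sum fun l hl => informationRate_le hw hl).trans_eq hw.2
  · have hl : ∀ k, Function.update μ k₀ γ k ∈ E.means := fun k => by
      by_cases hk : k = k₀
      · subst hk; simpa using h.threshold_mem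
      · simpa [hk] using h.mem_means k
    -- Needed because the real infimum over an empty family would be `0`.
    have hne : (alternatives E K γ (some k₀)).Nonempty :=
      closure_nonempty_iff.1 ⟨_, mem_closure_alternatives hl (Or.inl (by simp))⟩
    have := hne.to_subtype
    refine le_ciInf fun l => ?_
    have h1 := le_of_mem_alternatives h.mem_means h.threshold_mem h.lt_of_ne h.lt_threshold
      h.le_threshold h.mem_Ico l.2
    have hX := h.sum_deviationInv_pos
    simp only [h.proportions_eq, div_mul_eq_mul_div]
    rw [← Finset.sum_div, le_div_iff₀ hX, characteristicTime, one_div, mul_inv, inv_inv,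
      mul_assoc, inv_mul_cancel₀ hX.ne', mul_one]
    exact h1

/-- A maximizer leaves no slack in the pair constraints at the mixed means of level `z`. Comparing
with the constraint at the minimizer for the ratio `w j / w k₀` makes the compensation surplus
nonpositive, so the two mixed means agree and the ratio is `deviationInv`. -/
theorem informationRate_lt (h : IsOptimalLevel E γ μ k₀ z)
    {w : Fin K → ℝ} (hw : w ∈ stdSimplex ℝ (Fin K))
    (hne : w ≠ proportions E μ k₀ z) :
    informationRate E γ μ (some k₀) w
      < informationRate E γ μ (some k₀) (proportions E μ k₀ z) := by
  have hT := h.characteristicTime_pos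
  rw [h.informationRate_proportions]
  by_contra! hcon
  refine hne ?_
  set r := informationRate E γ μ (some k₀) w
  have hr : ∀ l ∈ alternatives E K γ (some k₀), r ≤ ∑ k, w k * E.d (μ k) (l k) := fun l hl =>
    informationRate_le hw hl
  have hr0 : 0 < r := (inv_pos.2 hT).trans_le hcon
  have h0 := le_weight_mul_threshold h.mem_means h.threshold_mem hr
  have hw0 : 0 < w k₀ := by
    refine lt_of_le_of_ne (hw.1 k₀) fun h' => ?_
    rw [← h', zero_mul] at h0
    linarith
  have heq : ∀ j, j ≠ k₀ → w k₀ * E.d (μ k₀) (mixedMean μ j k₀ (deviationInv E μ j k₀ z))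
      + w j * E.d (μ j) (mixedMean μ j k₀ (deviationInv E μ j k₀ z)) ≤ r := by
    intro j hj
    by_contra! hlt
    have := (mul_characteristicTime_le h.mem_means h.lt_of_ne h.pos h.mem_Ico h.equilibrium_le
      h.eq_threshold h0 fun i hi => le_weight_mul_common h.mem_means hr hi
        (mixedMean_mem_means h.mem_means (h.lt_of_ne _ hi) (h.deviationInv_nonneg _))).2
          ⟨j, hj, hlt⟩
    rw [hw.2] at this
    have h1 : 1 ≤ r * characteristicTime E μ k₀ z := by
      rwa [← one_div, div_le_iff₀ hT] at hcon
    linarith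
  have hwx : ∀ k, w k = w k₀ * deviationInv E μ k k₀ z := by
    intro j
    by_cases hj : j = k₀
    · rw [hj, deviationInv_self, mul_one]
    have hjk := h.lt_of_ne j hj
    set t := w j / w k₀ with ht
    have htw : w j = w k₀ * t := by rw [ht]; field_simp
    have ht0 : 0 ≤ t := div_nonneg (hw.1 j) hw0.le
    have hc := mixedMean_mem_means h.mem_means hjk ht0
    have hm := mixedMean_mem_means h.mem_means hjk (h.deviationInv_nonneg j)
    have h1 := le_weight_mul_common h.mem_means hr hj hc
    have h2 := heq j hj
    have h3 := deviation_add h.mem_means hjk ht0 hm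
    rw [htw] at h1 h2 ⊢
    -- Tightness at level `z` together with the lower bound `r` at the mixed mean of `t` leaves no
    -- room for the surplus from `deviation_add`.
    have h4 : w k₀ * ((1 + t) * E.d (mixedMean μ j k₀ t)
        (mixedMean μ j k₀ (deviationInv E μ j k₀ z))) ≤ 0 := by
      rw [deviation] at h3
      nlinarith
    congr 1
    by_contra hcne
    have hmne : mixedMean μ j k₀ t ≠ mixedMean μ j k₀ (deviationInv E μ j k₀ z) := fun h' =>
      hcne ((strictMonoOn_mixedMean hjk).injOn ht0 (h.deviationInv_nonneg j) h')
    have := d_pos hc hm hmne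
    have : 0 < w k₀ * ((1 + t) * E.d (mixedMean μ j k₀ t)
        (mixedMean μ j k₀ (deviationInv E μ j k₀ z))) := by positivity
    linarith
  have hsum : w k₀ * ∑ k, deviationInv E μ k k₀ z = 1 := by
    rw [Finset.mul_sum, ← hw.2]
    exact Finset.sum_congr rfl fun k _ => (hwx k).symm
  ext k
  rw [h.proportions_eq, eq_div_iff h.sum_deviationInv_pos.ne', hwx k]
  linear_combination deviationInv E μ k k₀ z * hsum

end IsOptimalLevel

end Duality
end

/-! ### Independence of past and next slot, and change of measure on the history. -/

noncomputable section

section ChangeOfMeasure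

open ExpFamily Filter Topology

variable {E : ExpFamily} {K : ℕ} {slice : ℕ → Outcome K → Fin K}

instance isProbabilityMeasure_outcomeMeasure (l : Fin K → ℝ) :
    IsProbabilityMeasure (outcomeMeasure E l) := by
  unfold outcomeMeasure; infer_instance

theorem measurePreserving_outcome (l : Fin K → ℝ) (t : ℕ) (k : Fin K) :
    MeasurePreserving (fun ω : Outcome K => ω t k) (outcomeMeasure E l) (E.law (l k)) :=
  (measurePreserving_eval (fun k => E.law (l k)) k).comp
    (measurePreserving_eval_infinitePi
      (fun _ : ℕ => Measure.pi fun k : Fin K => E.law (l k)) t)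

theorem measurable_eval_pair : Measurable (fun p : Fin K × (Fin K → ℝ) => p.2 p.1) :=
  measurable_from_prod_countable_right fun k => measurable_pi_apply k

/-- By recursion every past choice is a function of earlier slots only; this is the source of the
independence from slot `t`. -/
theorem history_le_iSup (h : ∀ t, Measurable[history slice t] (slice t)) (t : ℕ) :
    history slice t ≤ ⨆ s ∈ Set.Iio t,
      MeasurableSpace.comap (fun ω : Outcome K => ω s) inferInstance := by
  induction t using Nat.strong_induction_on with
  | _ t ih =>
    refine iSup_le fun s => ?_
    set m : MeasurableSpace (Outcome K) := ⨆ s ∈ Set.Iio t,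
      MeasurableSpace.comap (fun ω : Outcome K => ω s) inferInstance with hm
    have hle : (⨆ r ∈ Set.Iio (s : ℕ),
        MeasurableSpace.comap (fun ω : Outcome K => ω r) inferInstance) ≤ m :=
      biSup_mono fun r hr => lt_trans hr s.2
    have hs : Measurable[m] (slice s) := (h s).mono ((ih s s.2).trans hle) le_rfl
    have he : Measurable[m] (fun ω : Outcome K => ω s) :=
      Measurable.of_comap_le (le_biSup (fun s : ℕ =>
        MeasurableSpace.comap (fun ω : Outcome K => ω s) inferInstance) (Set.mem_Iio.2 s.2))
    have hv : Measurable[m] (fun ω : Outcome K => ω s (slice s ω)) :=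
      measurable_eval_pair.comp (hs.prodMk he)
    exact (hs.prodMk hv).comap_le

theorem indep_history (h : ∀ t, Measurable[history slice t] (slice t)) (l : Fin K → ℝ) (t : ℕ) :
    Indep (history slice t) (MeasurableSpace.comap (fun ω : Outcome K => ω t) inferInstance)
      (outcomeMeasure E l) := by
  have hI : iIndepFun (fun (i : ℕ) (ω : Outcome K) => ω i) (outcomeMeasure E l) :=
    iIndepFun_infinitePi (P := fun _ : ℕ => Measure.pi fun k : Fin K => E.law (l k))
      (X := fun _ x => x) fun _ => measurable_id
  have := indep_iSup_of_disjoint (fun i => (measurable_pi_apply i).comap_le) hI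
    (S := Set.Iio t) (T := {t}) (by simp)
  refine indep_of_indep_of_le_left ?_ (history_le_iSup h t)
  simpa using this

theorem indepFun_history (h : ∀ t, Measurable[history slice t] (slice t)) (l : Fin K → ℝ) (t : ℕ)
    {β β' : Type*} [MeasurableSpace β] [MeasurableSpace β'] {f : Outcome K → β}
    (hf : Measurable[history slice t] f) {g : (Fin K → ℝ) → β'} (hg : Measurable g) :
    IndepFun f (fun ω => g (ω t)) (outcomeMeasure E l) := by
  refine indep_of_indep_of_le_left (indep_of_indep_of_le_right (indep_history h l t) ?_)
    hf.comap_le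
  exact (hg.comp (comap_measurable fun ω : Outcome K => ω t)).comap_le

theorem measurableSet_slice_eq (h : ∀ t, Measurable[history slice t] (slice t)) (t : ℕ)
    (k : Fin K) : MeasurableSet[history slice t] {ω | slice t ω = k} :=
  h t (measurableSet_singleton k)

/-- Integration of a function of the past and the next observation. -/
theorem lintegral_mul_observation (h : ∀ t, Measurable[history slice t] (slice t))
    (l : Fin K → ℝ) (t : ℕ) {f : Outcome K → ENNReal} (hf : Measurable[history slice t] f)
    {g : Fin K × ℝ → ENNReal} (hg : Measurable g) :
    ∫⁻ ω, f ω * g (observation slice t ω) ∂(outcomeMeasure E l)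
      = ∑ k, (∫⁻ ω in {ω | slice t ω = k}, f ω ∂(outcomeMeasure E l))
          * ∫⁻ x, g (k, x) ∂(E.law (l k)) := by
  have hle := history_le slice h t
  have hk := measurableSet_slice_eq h t
  have hgk : ∀ k : Fin K, Measurable fun x : ℝ => g (k, x) := fun k =>
    hg.comp measurable_prodMk_left
  have hfk : ∀ k, Measurable[history slice t] ({ω | slice t ω = k}.indicator f) := fun k =>
    hf.indicator (hk k)
  -- On `slice t ω = k` the new value is `ω t k`, which is independent of the past; each summand
  -- therefore factorizes.
  have hsum : ∀ ω, f ω * g (observation slice t ω)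
      = ∑ k, {ω | slice t ω = k}.indicator f ω * g (k, ω t k) := by
    intro ω
    rw [Finset.sum_eq_single (slice t ω)]
    · simp [observation]
    · intro k _ hne
      rw [Set.indicator_of_notMem (fun h' => hne h'.symm), zero_mul]
    · simp
  have hev : ∀ k : Fin K, Measurable fun ω : Outcome K => g (k, ω t k) := fun k =>
    (hgk k).comp ((measurable_pi_apply k).comp (measurable_pi_apply t))
  simp_rw [hsum]
  rw [lintegral_finsetSum
    (f := fun k ω => {ω | slice t ω = k}.indicator f ω * g (k, ω t k)) _
    fun k _ => ((hfk k).mono hle le_rfl).mul (hev k)]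
  refine Finset.sum_congr rfl fun k _ => ?_
  rw [lintegral_mul_eq_lintegral_mul_lintegral_of_indepFun'' ((hfk k).mono hle le_rfl).aemeasurable
    (hev k).aemeasurable (indepFun_history h l t (hfk k) ((hgk k).comp (measurable_pi_apply k))),
    lintegral_indicator (hle _ (hk k)),
    (measurePreserving_outcome l t k).lintegral_comp (hgk k)]

theorem history_mono (slice : ℕ → Outcome K → Fin K) : Monotone (history slice) :=
  fun _ t hst => iSup_le fun i =>
    le_iSup (fun j : Fin t => MeasurableSpace.comap (observation slice j) inferInstance)
      (Fin.castLE hst i)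

theorem measurable_observation (slice : ℕ → Outcome K → Fin K) {s t : ℕ} (hst : s < t) :
    Measurable[history slice t] (observation slice s) :=
  Measurable.of_comap_le
    (le_iSup (fun j : Fin t => MeasurableSpace.comap (observation slice j) inferInstance) ⟨s, hst⟩)

/-- Sets determined by the history up to time `t` and the next observation. -/
def historyRectangles (slice : ℕ → Outcome K → Fin K) (t : ℕ) : Set (Set (Outcome K)) :=
  {s | ∃ A D, MeasurableSet[history slice t] A ∧ MeasurableSet D ∧
    s = A ∩ observation slice t ⁻¹' D}

theorem isPiSystem_historyRectangles (slice : ℕ → Outcome K → Fin K) (t : ℕ) :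
    IsPiSystem (historyRectangles slice t) := by
  rintro _ ⟨A, D, hA, hD, rfl⟩ _ ⟨A', D', hA', hD', rfl⟩ _
  exact ⟨A ∩ A', D ∩ D', MeasurableSet.inter hA hA', hD.inter hD', by
    rw [Set.preimage_inter, Set.inter_inter_inter_comm]⟩

theorem history_succ_eq_generateFrom (slice : ℕ → Outcome K → Fin K) (t : ℕ) :
    history slice (t + 1) = MeasurableSpace.generateFrom (historyRectangles slice t) := by
  apply le_antisymm
  · refine iSup_le fun s => ?_
    rintro _ ⟨D, hD, rfl⟩
    rcases (Nat.lt_succ_iff.1 s.2).eq_or_lt with hs | hs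
    · refine MeasurableSpace.measurableSet_generateFrom ⟨Set.univ, D, MeasurableSet.univ, hD, ?_⟩
      rw [Set.univ_inter, hs]
    · exact MeasurableSpace.measurableSet_generateFrom ⟨observation slice s ⁻¹' D, Set.univ,
        measurable_observation slice hs hD, MeasurableSet.univ, by simp⟩
  · refine MeasurableSpace.generateFrom_le ?_
    rintro _ ⟨A, D, hA, hD, rfl⟩
    exact MeasurableSet.inter (history_mono slice t.le_succ _ hA)
      (measurable_observation slice t.lt_succ_self hD)

/-- The log-likelihood ratio of the models `l` and `l'` for one observation. -/
def observationLLR (E : ExpFamily) (l l' : Fin K → ℝ) (p : Fin K × ℝ) : ℝ :=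
  E.logLikelihoodRatio (l p.1) (l' p.1) p.2

theorem measurable_observationLLR (l l' : Fin K → ℝ) : Measurable (observationLLR E l l') :=
  measurable_from_prod_countable_right fun k =>
    measurable_logLikelihoodRatio (E := E) (l k) (l' k)

/-- The log-likelihood ratio of the first `t` observations. -/
def historyLLR (E : ExpFamily) (slice : ℕ → Outcome K → Fin K) (l l' : Fin K → ℝ) (t : ℕ)
    (ω : Outcome K) : ℝ :=
  ∑ s ∈ Finset.range t, observationLLR E l l' (observation slice s ω)

theorem measurable_historyLLR (slice : ℕ → Outcome K → Fin K) (l l' : Fin K → ℝ) (t : ℕ) :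
    Measurable[history slice t] (historyLLR E slice l l' t) :=
  Finset.measurable_fun_sum _ fun _ hs => (measurable_observationLLR l l').comp
    (measurable_observation slice (Finset.mem_range.1 hs))

/-- Change of measure on the history up to time `t`. -/
theorem outcomeMeasure_eq_setLIntegral (h : ∀ t, Measurable[history slice t] (slice t))
    {l l' : Fin K → ℝ} (hl : ∀ k, l k ∈ E.means) (hl' : ∀ k, l' k ∈ E.means) (t : ℕ) :
    ∀ A : Set (Outcome K), MeasurableSet[history slice t] A → outcomeMeasure E l' A
      = ∫⁻ ω in A, ENNReal.ofReal (Real.exp (-historyLLR E slice l l' t ω))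
          ∂(outcomeMeasure E l) := by
  induction t with
  | zero =>
    intro A hA
    have hbot : history slice 0 = ⊥ := by simp [history]
    rw [hbot, MeasurableSpace.measurableSet_bot_iff] at hA
    rcases hA with rfl | rfl <;> simp [historyLLR]
  | succ t ih =>
    intro A hA
    set D : Outcome K → ENNReal := fun ω =>
      ENNReal.ofReal (Real.exp (-historyLLR E slice l l' t ω)) with hD
    set φ : Fin K × ℝ → ENNReal := fun p =>
      ENNReal.ofReal (Real.exp (-observationLLR E l l' p)) with hφ
    have hDm : Measurable[history slice t] D :=
      ENNReal.measurable_ofReal.comp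
        (Real.measurable_exp.comp (measurable_historyLLR slice l l' t).neg)
    have hφm : Measurable φ := ENNReal.measurable_ofReal.comp
        (Real.measurable_exp.comp (measurable_observationLLR l l').neg)
    have hmul : ∀ ω, ENNReal.ofReal (Real.exp (-historyLLR E slice l l' (t + 1) ω))
        = D ω * φ (observation slice t ω) := fun ω => by
      rw [hD, hφ, ← ENNReal.ofReal_mul (Real.exp_pos _).le, ← Real.exp_add, historyLLR,
        Finset.sum_range_succ, neg_add, historyLLR]
    simp_rw [hmul]
    have hle := history_le slice h (t + 1)
    rw [← withDensity_apply _ (hle _ hA)]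
    -- On a rectangle both sides factorize slice by slice: the past factor is the induction
    -- hypothesis, the other the density of a single law.
    have hrect : ∀ s ∈ historyRectangles slice t, outcomeMeasure E l' s
        = (outcomeMeasure E l).withDensity (fun ω => D ω * φ (observation slice t ω)) s := by
      rintro _ ⟨B, C, hB, hC, rfl⟩
      have hBC : MeasurableSet (B ∩ observation slice t ⁻¹' C) := hle _ <| by
        rw [history_succ_eq_generateFrom]
        exact MeasurableSpace.measurableSet_generateFrom ⟨B, C, hB, hC, rfl⟩
      have h1 : outcomeMeasure E l' (B ∩ observation slice t ⁻¹' C)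
          = ∫⁻ ω, B.indicator 1 ω * C.indicator 1 (observation slice t ω)
              ∂(outcomeMeasure E l') := by
        rw [← lintegral_indicator_one hBC]
        refine lintegral_congr fun ω => ?_
        by_cases h1 : ω ∈ B <;> by_cases h2 : observation slice t ω ∈ C <;> simp [h1, h2]
      have h2 : (outcomeMeasure E l).withDensity (fun ω => D ω * φ (observation slice t ω))
            (B ∩ observation slice t ⁻¹' C)
          = ∫⁻ ω, B.indicator D ω * C.indicator φ (observation slice t ω)
              ∂(outcomeMeasure E l) := by
        rw [withDensity_apply _ hBC, ← lintegral_indicator hBC]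
        refine lintegral_congr fun ω => ?_
        by_cases h1 : ω ∈ B <;> by_cases h2 : observation slice t ω ∈ C <;> simp [h1, h2]
      have hB' : MeasurableSet B := history_le slice h t _ hB
      have hBm : Measurable[history slice t] (B.indicator (1 : Outcome K → ENNReal)) :=
        Measurable.indicator (@measurable_const _ _ _ (history slice t) 1) hB
      rw [h1, h2, lintegral_mul_observation h l' t hBm
        (measurable_one.indicator hC), lintegral_mul_observation h l t (hDm.indicator hB)
        (hφm.indicator hC)]
      refine Finset.sum_congr rfl fun k _ => ?_
      congr 1
      · have hk := measurableSet_slice_eq h t k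
        rw [lintegral_indicator_one hB', Measure.restrict_apply hB',
          ih _ (MeasurableSet.inter hB hk), lintegral_indicator hB', Measure.restrict_restrict hB']
      · have hCk : MeasurableSet {x : ℝ | (k, x) ∈ C} := measurable_prodMk_left hC
        have e1 : ∀ x : ℝ, C.indicator (1 : Fin K × ℝ → ENNReal) (k, x)
          = {x : ℝ | (k, x) ∈ C}.indicator 1 x := fun x => rfl
        have e2 : ∀ x : ℝ, C.indicator φ (k, x)
          = {x : ℝ | (k, x) ∈ C}.indicator (fun x => φ (k, x)) x := fun x => rfl
        simp_rw [e1, e2]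
        rw [lintegral_indicator_one hCk, lintegral_indicator hCk,
          law_apply_eq_lintegral (hl k) (hl' k) hCk]
        rfl
    refine ext_on_measurableSpace_of_generate_finite _ (historyRectangles slice t) hrect hle
      (history_succ_eq_generateFrom slice t) (isPiSystem_historyRectangles slice t) ?_ hA
    exact hrect _ ⟨Set.univ, Set.univ, MeasurableSet.univ, MeasurableSet.univ, by simp⟩

end ChangeOfMeasure
end

/-! ### Likelihood ratio at the truncated stopping time and the variational bound. -/

noncomputable section

namespace Algorithm

open ExpFamily Filter Topology

variable {E : ExpFamily} {K : ℕ} (A : Algorithm K)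

theorem measurableSet_lt_tau (t : ℕ) : MeasurableSet[history A.slice t] {ω | (t : ℕ∞) < A.τ ω} :=
  A.isStoppingTime.measurableSet_gt t

theorem measurableSet_tau_eq (t : ℕ) : MeasurableSet[history A.slice t] {ω | A.τ ω = t} :=
  A.isStoppingTime.measurableSet_eq t

theorem measurableSet_decision_inter (a : Option (Fin K)) (t : ℕ) :
    MeasurableSet[history A.slice t] ({ω | A.decision ω = a} ∩ {ω | A.τ ω = t}) := by
  have h := ((A.isStoppingTime.measurableSet _).1 (A.measurable_decision
    (show MeasurableSet[⊤] ({a} : Set (Option (Fin K))) from trivial))).2 t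
  have heq : {ω | A.decision ω = a} ∩ {ω | A.τ ω = t}
      = A.decision ⁻¹' {a} ∩ {ω | A.τ ω ≤ t} ∩ {ω | A.τ ω = t} := by
    ext ω
    constructor
    · rintro ⟨h1, h2⟩
      exact ⟨⟨h1, le_of_eq h2⟩, h2⟩
    · rintro ⟨⟨h1, _⟩, h2⟩
      exact ⟨h1, h2⟩
  rw [heq]
  exact MeasurableSet.inter h (A.measurableSet_tau_eq t)

/-- The log-likelihood ratio of the observations made before the stopping time and slot `n`. -/
def stoppedLLR (E : ExpFamily) (l l' : Fin K → ℝ) (n : ℕ) (ω : Outcome K) : ℝ :=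
  ∑ s ∈ Finset.range n, {ω | (s : ℕ∞) < A.τ ω}.indicator
    (fun ω => observationLLR E l l' (observation A.slice s ω)) ω

theorem stoppedLLR_of_tau_eq (l l' : Fin K → ℝ) {n t : ℕ} (htn : t ≤ n) {ω : Outcome K}
    (hω : A.τ ω = t) : A.stoppedLLR E l l' n ω = historyLLR E A.slice l l' t ω := by
  rw [stoppedLLR, historyLLR, ← Finset.sum_subset (Finset.range_subset_range.2 htn)]
  · refine Finset.sum_congr rfl fun s hs => Set.indicator_of_mem ?_ _
    rw [Set.mem_ofPred_eq, hω]
    exact_mod_cast Finset.mem_range.1 hs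
  · intro s _ hs
    refine Set.indicator_of_notMem ?_ _
    rw [Set.mem_ofPred_eq, hω]
    simpa using hs

theorem stoppedLLR_of_lt_tau (l l' : Fin K → ℝ) {n : ℕ} {ω : Outcome K}
    (hω : (n : ℕ∞) < A.τ ω) : A.stoppedLLR E l l' n ω = historyLLR E A.slice l l' n ω := by
  refine Finset.sum_congr rfl fun s hs => Set.indicator_of_mem ?_ _
  exact lt_trans (by exact_mod_cast Finset.mem_range.1 hs) hω

theorem measurable_stoppedLLR (l l' : Fin K → ℝ) (n : ℕ) :
    Measurable (A.stoppedLLR E l l' n) := by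
  refine Finset.measurable_fun_sum _ fun s _ => Measurable.indicator ?_ ?_
  · exact (measurable_observationLLR l l').comp ((measurable_observation A.slice
      s.lt_succ_self).mono (history_le _ A.measurable_slice _) le_rfl)
  · exact history_le _ A.measurable_slice _ _ (A.measurableSet_lt_tau s)

theorem measure_eq_sum_tau (m : Measure (Outcome K)) {C : Set (Outcome K)} {n : ℕ}
    (hC : ∀ t ∈ Finset.range (n + 1), MeasurableSet (C ∩ {ω | A.τ ω = t})) :
    m C = ∑ t ∈ Finset.range (n + 1), m (C ∩ {ω | A.τ ω = t})
      + m (C ∩ {ω | (n : ℕ∞) < A.τ ω}) := by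
  have hU : C = (⋃ t ∈ Finset.range (n + 1), C ∩ {ω | A.τ ω = t})
      ∪ C ∩ {ω | (n : ℕ∞) < A.τ ω} := by
    ext ω
    simp only [Set.mem_union, Set.mem_iUnion, Set.mem_inter_iff, Set.mem_ofPred_eq,
      Finset.mem_range, exists_prop]
    constructor
    · intro hω
      rcases lt_or_ge (n : ℕ∞) (A.τ ω) with h | h
      · exact Or.inr ⟨hω, h⟩
      · lift A.τ ω to ℕ using ne_top_of_le_ne_top (ENat.natCast_ne_top n) h with t ht
        exact Or.inl ⟨t, Nat.lt_succ_iff.2 (by exact_mod_cast h), hω, rfl⟩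
    · rintro (⟨_, _, h, _⟩ | ⟨h, _⟩) <;> exact h
  conv_lhs => rw [hU]
  rw [measure_union' ?_ (Finset.measurableSet_biUnion _ hC), measure_biUnion_finset ?_ hC]
  · intro s _ t _ hst
    refine Set.disjoint_left.2 fun ω h1 h2 => hst ?_
    have : (s : ℕ∞) = t := h1.2.symm.trans h2.2
    exact_mod_cast this
  · refine Set.disjoint_left.2 fun ω h1 h2 => ?_
    simp only [Set.mem_iUnion, Finset.mem_range, exists_prop] at h1
    obtain ⟨t, ht, h1⟩ := h1
    have h3 : (n : ℕ∞) < t := (show (n : ℕ∞) < A.τ ω from h2.2).trans_eq h1.2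
    have h4 : n < t := by exact_mod_cast h3
    omega

/-- Change of measure at the stopping time truncated at `n`. -/
theorem outcomeMeasure_eq_setLIntegral_stoppedLLR {l l' : Fin K → ℝ} (hl : ∀ k, l k ∈ E.means)
    (hl' : ∀ k, l' k ∈ E.means) {C : Set (Outcome K)} {n : ℕ}
    (hC : ∀ t ∈ Finset.range (n + 1), MeasurableSet[history A.slice t] (C ∩ {ω | A.τ ω = t}))
    (hCn : MeasurableSet[history A.slice n] (C ∩ {ω | (n : ℕ∞) < A.τ ω})) :
    outcomeMeasure E l' C
      = ∫⁻ ω in C, ENNReal.ofReal (Real.exp (-A.stoppedLLR E l l' n ω)) ∂(outcomeMeasure E l) := by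
  have hle := history_le _ A.measurable_slice
  have hC' : ∀ t ∈ Finset.range (n + 1), MeasurableSet (C ∩ {ω | A.τ ω = t}) := fun t ht =>
    hle t _ (hC t ht)
  rw [← withDensity_apply' _ C, A.measure_eq_sum_tau _ hC', A.measure_eq_sum_tau _ hC']
  congr 1
  · refine Finset.sum_congr rfl fun t ht => ?_
    rw [withDensity_apply _ (hC' t ht),
      outcomeMeasure_eq_setLIntegral A.measurable_slice hl hl' t _ (hC t ht)]
    refine setLIntegral_congr_fun (hC' t ht) fun ω hω => ?_
    rw [A.stoppedLLR_of_tau_eq l l' (Nat.lt_succ_iff.1 (Finset.mem_range.1 ht)) hω.2]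
  · rw [withDensity_apply _ (hle n _ hCn),
      outcomeMeasure_eq_setLIntegral A.measurable_slice hl hl' n _ hCn]
    refine setLIntegral_congr_fun (hle n _ hCn) fun ω hω => ?_
    rw [A.stoppedLLR_of_lt_tau l l' hω.2]

/-- The probability that slice `k` is measured in slot `s`. -/
def measureProb (E : ExpFamily) (l : Fin K → ℝ) (s : ℕ) (k : Fin K) : ℝ :=
  (outcomeMeasure E l).real ({ω | (s : ℕ∞) < A.τ ω} ∩ {ω | A.slice s ω = k})

theorem indicator_observationLLR (l l' : Fin K → ℝ) (s : ℕ) (ω : Outcome K) :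
    {ω | (s : ℕ∞) < A.τ ω}.indicator
        (fun ω => observationLLR E l l' (observation A.slice s ω)) ω
      = ∑ k, ({ω | (s : ℕ∞) < A.τ ω} ∩ {ω | A.slice s ω = k}).indicator (fun _ => (1 : ℝ)) ω
          * E.logLikelihoodRatio (l k) (l' k) (ω s k) := by
  rw [Finset.sum_eq_single (A.slice s ω)]
  · by_cases h : (s : ℕ∞) < A.τ ω <;> simp [h, observationLLR, observation]
  · intro k _ hk
    rw [Set.indicator_of_notMem (fun h => hk h.2.symm), zero_mul]
  · simp

theorem stoppedLLR_eq_sum (l l' : Fin K → ℝ) (n : ℕ) :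
    A.stoppedLLR E l l' n = fun ω => ∑ s ∈ Finset.range n, ∑ k,
      ({ω | (s : ℕ∞) < A.τ ω} ∩ {ω | A.slice s ω = k}).indicator (fun _ => (1 : ℝ)) ω
          * E.logLikelihoodRatio (l k) (l' k) (ω s k) :=
  funext fun ω => Finset.sum_congr rfl fun s _ => A.indicator_observationLLR l l' s ω

/-- Whether slot `s` is used and on which slice is decided by the history up to `s`, hence
independently of `ω s k`. Summing these products gives Wald's identity for the truncated
log-likelihood ratio. -/
theorem integrable_and_integral_stopped_term {l l' : Fin K → ℝ} (hl : ∀ k, l k ∈ E.means)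
    (hl' : ∀ k, l' k ∈ E.means) (s : ℕ) (k : Fin K) :
    Integrable (fun ω => ({ω | (s : ℕ∞) < A.τ ω} ∩ {ω | A.slice s ω = k}).indicator
        (fun _ => (1 : ℝ)) ω * E.logLikelihoodRatio (l k) (l' k) (ω s k)) (outcomeMeasure E l) ∧
    ∫ ω, ({ω | (s : ℕ∞) < A.τ ω} ∩ {ω | A.slice s ω = k}).indicator
        (fun _ => (1 : ℝ)) ω * E.logLikelihoodRatio (l k) (l' k) (ω s k) ∂(outcomeMeasure E l)
      = A.measureProb E l s k * E.d (l k) (l' k) := by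
  have hle := history_le _ A.measurable_slice s
  have hs : MeasurableSet[history A.slice s]
      ({ω | (s : ℕ∞) < A.τ ω} ∩ {ω | A.slice s ω = k}) :=
    MeasurableSet.inter (A.measurableSet_lt_tau s) (measurableSet_slice_eq A.measurable_slice s k)
  have hf : Measurable[history A.slice s]
      (({ω | (s : ℕ∞) < A.τ ω} ∩ {ω | A.slice s ω = k}).indicator (fun _ => (1 : ℝ))) :=
    Measurable.indicator (@measurable_const _ _ _ (history A.slice s) 1) hs
  have hg : Measurable fun x : Fin K → ℝ => E.logLikelihoodRatio (l k) (l' k) (x k) :=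
    (measurable_logLikelihoodRatio _ _).comp (measurable_pi_apply k)
  have hmp := measurePreserving_outcome (E := E) l s k
  have hgi : Integrable (fun ω : Outcome K => E.logLikelihoodRatio (l k) (l' k) (ω s k))
      (outcomeMeasure E l) :=
    hmp.integrable_comp_of_integrable (integrable_logLikelihoodRatio (hl k) (l' k))
  have hfi : Integrable (({ω | (s : ℕ∞) < A.τ ω} ∩ {ω | A.slice s ω = k}).indicator
      (fun _ => (1 : ℝ))) (outcomeMeasure E l) := (integrable_const 1).indicator (hle _ hs)
  have hind : IndepFun _ (fun ω : Outcome K => E.logLikelihoodRatio (l k) (l' k) (ω s k)) _ :=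
    indepFun_history A.measurable_slice (E := E) l s hf hg
  refine ⟨hind.integrable_mul hfi hgi, ?_⟩
  rw [hind.integral_fun_mul_eq_mul_integral hfi.1 hgi.1, integral_indicator_const _ (hle _ hs),
    smul_eq_mul, mul_one, measureProb, ← integral_logLikelihoodRatio (hl k) (hl' k),
    ← hmp.map_eq, integral_map hmp.measurable.aemeasurable
      (measurable_logLikelihoodRatio _ _).aestronglyMeasurable]

theorem integrable_stoppedLLR {l l' : Fin K → ℝ} (hl : ∀ k, l k ∈ E.means)
    (hl' : ∀ k, l' k ∈ E.means) (n : ℕ) :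
    Integrable (A.stoppedLLR E l l' n) (outcomeMeasure E l) := by
  rw [A.stoppedLLR_eq_sum]
  refine integrable_finsetSum _ fun s _ => ?_
  exact integrable_finsetSum _ fun k _ => (A.integrable_and_integral_stopped_term hl hl' s k).1

theorem integral_stoppedLLR {l l' : Fin K → ℝ} (hl : ∀ k, l k ∈ E.means)
    (hl' : ∀ k, l' k ∈ E.means) (n : ℕ) :
    ∫ ω, A.stoppedLLR E l l' n ω ∂(outcomeMeasure E l)
      = ∑ k, (∑ s ∈ Finset.range n, A.measureProb E l s k) * E.d (l k) (l' k) := by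
  rw [A.stoppedLLR_eq_sum]
  rw [integral_finsetSum _ fun s _ =>
    integrable_finsetSum _ fun k _ => (A.integrable_and_integral_stopped_term hl hl' s k).1]
  simp_rw [Finset.sum_mul]
  rw [Finset.sum_comm]
  refine Finset.sum_congr rfl fun s _ => ?_
  rw [integral_finsetSum _ fun k _ => (A.integrable_and_integral_stopped_term hl hl' s k).1]
  exact Finset.sum_congr rfl fun k _ => (A.integrable_and_integral_stopped_term hl hl' s k).2

/-- The double sum is the tail sum for the expectation of `min τ n`. -/
theorem ofReal_sum_measureProb_le (l : Fin K → ℝ) (n : ℕ) :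
    ENNReal.ofReal (∑ k, ∑ s ∈ Finset.range n, A.measureProb E l s k)
      ≤ A.sampleComplexity E l := by
  have hle := history_le _ A.measurable_slice
  have hlt : ∀ s : ℕ, MeasurableSet {ω | (s : ℕ∞) < A.τ ω} := fun s =>
    hle s _ (A.measurableSet_lt_tau s)
  have h1 : ∀ s : ℕ, ∑ k, A.measureProb E l s k
      = (outcomeMeasure E l).real {ω | (s : ℕ∞) < A.τ ω} := by
    intro s
    have hs := fun k => hle s _ (measurableSet_slice_eq A.measurable_slice s k)
    unfold measureProb
    rw [← measureReal_biUnion_finset]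
    · congr 1
      ext ω
      simp
    · intro i _ j _ hij
      exact Set.disjoint_left.2 fun ω h1 h2 => hij (h1.2.symm.trans h2.2)
    · exact fun k _ => (hlt s).inter (hs k)
  rw [Finset.sum_comm]
  simp_rw [h1]
  rw [ENNReal.ofReal_sum_of_nonneg fun _ _ => measureReal_nonneg]
  rw [Finset.sum_congr rfl fun s _ => ofReal_measureReal]
  have h2 : ∀ s : ℕ, outcomeMeasure E l {ω | (s : ℕ∞) < A.τ ω}
      = ∫⁻ ω, {ω | (s : ℕ∞) < A.τ ω}.indicator 1 ω ∂(outcomeMeasure E l) := fun s =>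
    (lintegral_indicator_one (hlt s)).symm
  rw [Finset.sum_congr rfl fun s _ => h2 s,
    ← lintegral_finsetSum _ fun s _ => measurable_one.indicator (hlt s)]
  refine lintegral_mono fun ω => ?_
  rcases eq_or_ne (A.τ ω) ⊤ with h | h
  · simp [h]
  · obtain ⟨m, hm⟩ := ENat.ne_top_iff_exists.1 h
    rw [← hm]
    have h3 : ∀ s : ℕ, {ω | (s : ℕ∞) < A.τ ω}.indicator (1 : Outcome K → ENNReal) ω
        = if s < m then 1 else 0 := fun s => by
      rw [Set.indicator_apply]
      simp [← hm]
    simp_rw [h3]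
    rw [← Finset.sum_filter, Finset.sum_const, nsmul_eq_mul, mul_one, ENat.toENNReal_coe]
    have : (Finset.filter (fun s => s < m) (Finset.range n)).card ≤ m := by
      calc _ ≤ (Finset.range m).card := Finset.card_le_card fun s hs => by
            simp only [Finset.mem_filter, Finset.mem_range] at hs ⊢; exact hs.2
        _ = m := Finset.card_range m
    exact_mod_cast this

/-- The variational (Donsker-Varadhan) bound for the event of taking decision `a` by time `n`. -/
theorem mul_measureReal_sub_log_le {l l' : Fin K → ℝ} (hl : ∀ k, l k ∈ E.means)
    (hl' : ∀ k, l' k ∈ E.means) (a : Option (Fin K)) (n : ℕ) {c : ℝ} (hc : 0 ≤ c) :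
    c * (outcomeMeasure E l).real ({ω | A.decision ω = a} ∩ {ω | A.τ ω ≤ n})
        - Real.log (1 + (Real.exp c - 1)
          * (outcomeMeasure E l').real ({ω | A.decision ω = a} ∩ {ω | A.τ ω ≤ n}))
      ≤ ∑ k, (∑ s ∈ Finset.range n, A.measureProb E l s k) * E.d (l k) (l' k) := by
  set P := outcomeMeasure E l
  set P' := outcomeMeasure E l'
  set C := {ω | A.decision ω = a} ∩ {ω | A.τ ω ≤ n} with hC
  set L := A.stoppedLLR E l l' n
  rw [← A.integral_stoppedLLR hl hl' n]
  have hle := history_le _ A.measurable_slice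
  have hCτ : ∀ t ∈ Finset.range (n + 1),
      C ∩ {ω | A.τ ω = t} = {ω | A.decision ω = a} ∩ {ω | A.τ ω = t} := by
    intro t ht
    ext ω
    refine ⟨fun h => ⟨h.1.1, h.2⟩, fun h => ⟨⟨h.1, ?_⟩, h.2⟩⟩
    rw [Set.mem_ofPred_eq, (show A.τ ω = t from h.2)]
    exact_mod_cast Nat.lt_succ_iff.1 (Finset.mem_range.1 ht)
  have hC1 : ∀ t ∈ Finset.range (n + 1),
      MeasurableSet[history A.slice t] (C ∩ {ω | A.τ ω = t}) := fun t ht => by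
    rw [hCτ t ht]; exact A.measurableSet_decision_inter a t
  have hC2 : C ∩ {ω | (n : ℕ∞) < A.τ ω} = ∅ := by
    refine Set.eq_empty_of_forall_notMem fun ω h => ?_
    exact absurd (show A.τ ω ≤ n from h.1.2) (not_le.2 h.2)
  have hD1 : ∀ t ∈ Finset.range (n + 1),
      MeasurableSet[history A.slice t] (Cᶜ ∩ {ω | A.τ ω = t}) := fun t ht => by
    have : Cᶜ ∩ {ω | A.τ ω = t} = {ω | A.τ ω = t} \ (C ∩ {ω | A.τ ω = t}) := by
      ext ω; simp only [Set.mem_inter_iff, Set.mem_compl_iff, Set.mem_sdiff]; tauto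
    rw [this]
    exact MeasurableSet.diff (A.measurableSet_tau_eq t) (hC1 t ht)
  have hD2 : Cᶜ ∩ {ω | (n : ℕ∞) < A.τ ω} = {ω | (n : ℕ∞) < A.τ ω} := by
    refine Set.inter_eq_right.2 fun ω h hω => ?_
    exact absurd (show A.τ ω ≤ n from hω.2) (not_le.2 h)
  have hCm : MeasurableSet C := by
    have : C = ⋃ t ∈ Finset.range (n + 1), C ∩ {ω | A.τ ω = t} := by
      ext ω
      simp only [Set.mem_iUnion, Set.mem_inter_iff, Set.mem_ofPred_eq, Finset.mem_range,
        exists_prop]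
      refine ⟨fun h => ?_, fun ⟨t, _, h, _⟩ => h⟩
      have h2 : A.τ ω ≤ n := h.2
      obtain ⟨t, ht⟩ := ENat.ne_top_iff_exists.1 (ne_top_of_le_ne_top (ENat.natCast_ne_top n) h2)
      refine ⟨t, ?_, h, ht.symm⟩
      rw [← ht] at h2
      exact Nat.lt_succ_iff.2 (by exact_mod_cast h2)
    rw [this]
    exact Finset.measurableSet_biUnion _ fun t ht => hle t _ (hC1 t ht)
  have hPC := A.outcomeMeasure_eq_setLIntegral_stoppedLLR hl hl' hC1
    (by rw [hC2]; exact @MeasurableSet.empty _ (history A.slice n))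
  have hPD := A.outcomeMeasure_eq_setLIntegral_stoppedLLR hl hl' hD1
    (by rw [hD2]; exact A.measurableSet_lt_tau n)
  -- Since `exp (-L)` is the density of `P'` on `C` and on its complement, the integral of `f` under
  -- `P` is `exp c * P' C + P' Cᶜ`, which is `Q`.
  set f : Outcome K → ℝ := fun ω => Real.exp (C.indicator (fun _ => c) ω - L ω) with hf
  have hfm : Measurable f := Real.measurable_exp.comp
    ((measurable_const.indicator hCm).sub (A.measurable_stoppedLLR l l' n))
  have hlint : ∫⁻ ω, ENNReal.ofReal (f ω) ∂P
      = ENNReal.ofReal (Real.exp c) * P' C + P' Cᶜ := by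
    rw [← lintegral_add_compl _ hCm, hPC, hPD, ← lintegral_const_mul']
    · congr 1
      · refine setLIntegral_congr_fun hCm fun ω hω => ?_
        simp only [hf]
        rw [Set.indicator_of_mem hω, ← ENNReal.ofReal_mul (Real.exp_pos _).le, ← Real.exp_add,
          sub_eq_add_neg]
      · refine setLIntegral_congr_fun hCm.compl fun ω hω => ?_
        simp only [hf]
        rw [Set.indicator_of_notMem hω, zero_sub]
    · exact ENNReal.ofReal_ne_top
  have hfi : Integrable f P := by
    refine ⟨hfm.aestronglyMeasurable, ?_⟩
    rw [hasFiniteIntegral_iff_ofReal (ae_of_all _ fun ω => (Real.exp_pos _).le), hlint]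
    exact ENNReal.add_lt_top.2 ⟨ENNReal.mul_lt_top ENNReal.ofReal_lt_top (measure_lt_top _ _),
      measure_lt_top _ _⟩
  set Q := 1 + (Real.exp c - 1) * P'.real C with hQ
  have hQ0 : 0 < Q := by
    have : 0 ≤ (Real.exp c - 1) * P'.real C :=
      mul_nonneg (sub_nonneg.2 (Real.one_le_exp hc)) measureReal_nonneg
    linarith
  have hint : ∫ ω, f ω ∂P = Q := by
    rw [integral_eq_lintegral_of_nonneg_ae (ae_of_all _ fun ω => (Real.exp_pos _).le)
      hfm.aestronglyMeasurable, hlint, ENNReal.toReal_add (by finiteness) (by finiteness),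
      ENNReal.toReal_mul, ENNReal.toReal_ofReal (Real.exp_pos _).le]
    change Real.exp c * P'.real C + P'.real Cᶜ = Q
    rw [probReal_compl_eq_one_sub hCm, hQ]
    ring
  have hLi := A.integrable_stoppedLLR hl hl' n
  have hφi : Integrable (C.indicator fun _ => c) P := (integrable_const c).indicator hCm
  -- Jensen's inequality by hand: integrate `u + 1 ≤ exp u` at `u = c * 1_C - L - log Q`.
  have hmono : ∫ ω, (C.indicator (fun _ => c) ω - L ω + (1 - Real.log Q)) ∂P
      ≤ ∫ ω, f ω / Q ∂P := by
    refine integral_mono ((hφi.sub hLi).add (integrable_const _)) (hfi.div_const Q) fun ω => ?_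
    have h1 := Real.add_one_le_exp (C.indicator (fun _ => c) ω - L ω - Real.log Q)
    rw [Real.exp_sub, Real.exp_log hQ0] at h1
    simp only [hf]
    linarith
  have hsplit : ∫ ω, (C.indicator (fun _ => c) ω - L ω + (1 - Real.log Q)) ∂P
      = ∫ ω, C.indicator (fun _ => c) ω ∂P - ∫ ω, L ω ∂P + ∫ _, (1 - Real.log Q) ∂P := by
    rw [← integral_sub hφi hLi]
    exact integral_add (hφi.sub hLi) (integrable_const _)
  rw [integral_div, hint, div_self hQ0.ne', hsplit, integral_indicator_const _ hCm] at hmono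
  simp only [smul_eq_mul, integral_const, probReal_univ, one_mul] at hmono
  linarith [mul_comm c (P.real C)]

end Algorithm

end

/-! ### The Bernoulli divergence as a tilting computation. -/

noncomputable section

theorem exp_neg_two_mul_log_div {a b : ℝ} (ha : 0 < a) (hb : 0 < b) :
    Real.exp (-2 * Real.log (a / b)) = (b / a) ^ 2 := by
  rw [show -2 * Real.log (a / b) = Real.log ((b / a) ^ 2) by
    rw [Real.log_pow, ← inv_div, Real.log_inv]; push_cast; ring]
  exact Real.exp_log (by positivity)

/-- The exponent is the difference of the log-odds of `δ` and `1 - δ`; this brings the Bernoulli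
case under the general formula for tilted measures. -/
theorem bernoulliMeasure_eq_tilted {δ : unitInterval} (h0 : (0 : ℝ) < δ) (h1 : (δ : ℝ) < 1) :
    bernoulliMeasure (1 : ℝ) 0 δ = (bernoulliMeasure (1 : ℝ) 0 (unitInterval.symm δ)).tilted
      (fun x => -2 * Real.log ((1 - δ) / δ) * x) := by
  have h1' : 0 < 1 - (δ : ℝ) := by linarith
  have hexp := exp_neg_two_mul_log_div h1' h0
  have hZ : ∫ x, Real.exp (-2 * Real.log ((1 - δ) / δ) * x)
      ∂(bernoulliMeasure (1 : ℝ) 0 (unitInterval.symm δ)) = δ / (1 - δ) := by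
    rw [integral_bernoulliMeasure]
    simp only [mul_one, mul_zero, Real.exp_zero, hexp, unitInterval.coe_symm_eq, smul_eq_mul]
    field_simp
    ring
  have ha : unitInterval.toNNReal δ = ((unitInterval.toNNReal (unitInterval.symm δ) : NNReal)
      : ENNReal) * ENNReal.ofReal ((δ / (1 - δ)) ^ 2 / (δ / (1 - δ))) := by
    rw [← ENNReal.ofReal_coe_nnreal, ← ENNReal.ofReal_coe_nnreal,
      ← ENNReal.ofReal_mul (NNReal.coe_nonneg _)]
    congr 1
    simp only [unitInterval.coe_toNNReal, unitInterval.coe_symm_eq]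
    field_simp
  have hb : unitInterval.toNNReal (unitInterval.symm δ) = ((unitInterval.toNNReal δ : NNReal)
      : ENNReal) * ENNReal.ofReal (1 / (δ / (1 - δ))) := by
    rw [← ENNReal.ofReal_coe_nnreal, ← ENNReal.ofReal_coe_nnreal,
      ← ENNReal.ofReal_mul (NNReal.coe_nonneg _)]
    congr 1
    simp only [unitInterval.coe_toNNReal, unitInterval.coe_symm_eq]
    field_simp
  rw [Measure.tilted, hZ]
  ext s hs
  rw [withDensity_apply _ hs, ← lintegral_indicator hs]
  simp only [bernoulliMeasure_def, unitInterval.symm_symm]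
  rw [lintegral_add_measure, lintegral_smul_measure, lintegral_smul_measure, lintegral_dirac,
    lintegral_dirac, Measure.add_apply, Measure.smul_apply, Measure.smul_apply,
    Measure.dirac_apply' _ hs, Measure.dirac_apply' _ hs]
  simp only [ENNReal.smul_def, smul_eq_mul]
  congr 1
  · by_cases h : (1 : ℝ) ∈ s
    · simp only [Set.indicator_of_mem h, mul_one, hexp, Pi.one_apply]
      exact ha
    · simp [h]
  · by_cases h : (0 : ℝ) ∈ s
    · simp only [Set.indicator_of_mem h, mul_zero, Real.exp_zero, Pi.one_apply, mul_one]
      exact hb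
    · simp [h]

theorem bernoulliKL_symm {δ : unitInterval} (h0 : (0 : ℝ) < δ) (h1 : (δ : ℝ) < 1) :
    bernoulliKL δ (unitInterval.symm δ) = (1 - 2 * δ) * Real.log ((1 - δ) / δ) := by
  have h1' : 0 < 1 - (δ : ℝ) := by linarith
  have hexp := exp_neg_two_mul_log_div h1' h0
  have h := toReal_klDiv_tilted_left_self
    (ν := bernoulliMeasure (1 : ℝ) 0 (unitInterval.symm δ))
    (f := fun x => -2 * Real.log ((1 - δ) / δ) * x) (integrable_bernoulliMeasure _ _ _ _) (by
      rw [← bernoulliMeasure_eq_tilted h0 h1]; exact integrable_bernoulliMeasure _ _ _ _)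
  rw [← bernoulliMeasure_eq_tilted h0 h1, integral_bernoulliMeasure, integral_bernoulliMeasure] at h
  rw [bernoulliKL, h]
  simp only [mul_one, mul_zero, Real.exp_zero, hexp, unitInterval.coe_symm_eq, smul_eq_mul]
  have : (1 - (δ : ℝ)) * (δ / (1 - δ)) ^ 2 + (1 - (1 - δ)) = ((1 - (δ : ℝ)) / δ)⁻¹ := by
    field_simp
    ring
  rw [this, Real.log_inv]
  ring

/-! ### The lower bound on the sample complexity. -/

section LowerBound

open Filter Topology

variable {E : ExpFamily} {K : ℕ} {γ : ℝ} {μ : Fin K → ℝ} {k₀ : Fin K} {z : ℝ}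

theorem IsOptimalLevel.eq_of_mem_correctAnswers (h : IsOptimalLevel E γ μ k₀ z)
    {a : Option (Fin K)} (ha : a ∈ correctAnswers γ μ) : a = some k₀ := by
  match a, ha with
  | none, ha => exact absurd (ha k₀) (not_le.2 h.lt_threshold)
  | some k, ha =>
    by_contra hne
    exact absurd (ha.2 k₀) (not_le.2 (h.lt_of_ne k fun h' => hne (by rw [h'])))

theorem Algorithm.tendsto_measureReal_decision (A : Algorithm K) (l : Fin K → ℝ)
    (hτ : outcomeMeasure E l {ω | A.τ ω < ⊤} = 1) (a : Option (Fin K)) :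
    Tendsto (fun n : ℕ => (outcomeMeasure E l).real ({ω | A.decision ω = a} ∩ {ω | A.τ ω ≤ n}))
      atTop (𝓝 ((outcomeMeasure E l).real {ω | A.decision ω = a})) := by
  have hU : ⋃ n : ℕ, ({ω | A.decision ω = a} ∩ {ω | A.τ ω ≤ n})
      = {ω | A.decision ω = a} ∩ {ω | A.τ ω < ⊤} := by
    ext ω
    simp only [Set.mem_iUnion, Set.mem_inter_iff, Set.mem_ofPred_eq, exists_and_left]
    refine and_congr_right fun _ => ⟨fun ⟨n, hn⟩ => hn.trans_lt (ENat.natCast_lt_top n),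
      fun hlt => ?_⟩
    obtain ⟨n, hn⟩ := ENat.ne_top_iff_exists.1 hlt.ne
    exact ⟨n, hn.ge⟩
  have hmono : Monotone fun n : ℕ => ({ω | A.decision ω = a} ∩ {ω | A.τ ω ≤ n}) :=
    fun m n hmn => Set.inter_subset_inter_right _ fun ω (hω : A.τ ω ≤ m) =>
      hω.trans (by exact_mod_cast hmn)
  have h1 := tendsto_measure_iUnion_atTop (μ := outcomeMeasure E l) hmono
  have hm : MeasurableSet {ω | A.τ ω < ⊤} := by
    have : {ω | A.τ ω < ⊤} = ⋃ n : ℕ, {ω | A.τ ω = n} := by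
      ext ω
      simp only [Set.mem_ofPred_eq, Set.mem_iUnion]
      refine ⟨fun hlt => ?_, fun ⟨n, hn⟩ => hn ▸ ENat.natCast_lt_top n⟩
      obtain ⟨n, hn⟩ := ENat.ne_top_iff_exists.1 hlt.ne
      exact ⟨n, hn.symm⟩
    rw [this]
    exact MeasurableSet.iUnion fun n =>
      history_le _ A.measurable_slice n _ (A.measurableSet_tau_eq n)
  rw [hU, measure_inter_conull ((prob_compl_eq_zero_iff hm).2 hτ)] at h1
  exact (ENNReal.tendsto_toReal (measure_ne_top _ _)).comp h1

/-- The lower bound on the sample complexity. -/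
theorem IsOptimalLevel.le_sampleComplexity (h : IsOptimalLevel E γ μ k₀ z)
    (hμ : μ ∈ loadModels E K γ) {δ : unitInterval} (h0 : (0 : ℝ) < δ) (h2 : (δ : ℝ) ≤ 1 / 2)
    (A : Algorithm K) (hA : A.IsPC E γ δ) :
    ENNReal.ofReal (characteristicTime E μ k₀ z * bernoulliKL δ (unitInterval.symm δ))
      ≤ A.sampleComplexity E μ := by
  have h1' : 0 < 1 - (δ : ℝ) := by linarith
  have hT := h.characteristicTime_pos
  set D := {ω | A.decision ω = some k₀} with hD
  -- The optimal Donsker–Varadhan parameter for an event of probability `1 - δ` under one law and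
  -- `δ` under the other; its value is then the Bernoulli divergence.
  set c := 2 * Real.log ((1 - δ) / δ) with hc
  have hratio : 1 ≤ (1 - (δ : ℝ)) / δ := by rw [one_le_div h0]; linarith
  have hc0 : 0 ≤ c := mul_nonneg zero_le_two (Real.log_nonneg hratio)
  have hexp : Real.exp c = ((1 - δ) / δ) ^ 2 := by
    rw [show c = Real.log (((1 - δ) / δ) ^ 2) by rw [hc, Real.log_pow]; push_cast; ring]
    exact Real.exp_log (by positivity)
  have hδQ : 1 + (Real.exp c - 1) * δ = (1 - δ) / δ := by
    rw [hexp]; field_simp; ring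
  -- The left side does not depend on the alternative, so it can play the role of `r` in the dual
  -- inequality. Truncation at `n` keeps the counts finite without assuming that `τ` is integrable.
  have hn : ∀ n : ℕ, ENNReal.ofReal ((c * (outcomeMeasure E μ).real (D ∩ {ω | A.τ ω ≤ n})
      - Real.log ((1 - δ) / δ)) * characteristicTime E μ k₀ z) ≤ A.sampleComplexity E μ := by
    intro n
    refine le_trans (ENNReal.ofReal_le_ofReal ?_) (A.ofReal_sum_measureProb_le μ n)
    refine h.mul_characteristicTime_le_sum fun l hl => ?_
    refine le_trans ?_ (A.mul_measureReal_sub_log_le h.mem_means hl.1.1 (some k₀) n hc0)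
    refine sub_le_sub_left (Real.log_le_log ?_ ?_) _
    · have : 0 ≤ (Real.exp c - 1)
          * (outcomeMeasure E l).real (D ∩ {ω | A.τ ω ≤ n}) :=
        mul_nonneg (sub_nonneg.2 (Real.one_le_exp hc0)) measureReal_nonneg
      linarith
    · rw [← hδQ]
      refine add_le_add_right (mul_le_mul_of_nonneg_left ?_
        (sub_nonneg.2 (Real.one_le_exp hc0))) _
      refine ENNReal.toReal_le_of_le_ofReal h0.le (le_trans (measure_mono ?_) (hA l hl.1).2)
      rintro ω ⟨hω, -⟩
      rw [Set.mem_ofPred_eq, (show A.decision ω = some k₀ from hω)]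
      exact hl.2
  have hD1 : 1 - (δ : ℝ) ≤ (outcomeMeasure E μ).real D := by
    have hbad : (outcomeMeasure E μ).real Dᶜ ≤ δ := by
      refine ENNReal.toReal_le_of_le_ofReal h0.le (le_trans (measure_mono ?_) (hA μ hμ).2)
      intro ω hω hmem
      exact hω (h.eq_of_mem_correctAnswers hmem)
    have hsum := measureReal_union_le (μ := outcomeMeasure E μ) D Dᶜ
    rw [Set.union_compl_self, probReal_univ] at hsum
    linarith
  -- As `τ` is almost surely finite, the truncation disappears in the limit.
  have hlim := A.tendsto_measureReal_decision μ (hA μ hμ).1 (some k₀)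
  have hlim2 := ENNReal.tendsto_ofReal (((hlim.const_mul c).sub_const
    (Real.log ((1 - δ) / δ))).mul_const (characteristicTime E μ k₀ z))
  refine le_trans (ENNReal.ofReal_le_ofReal ?_) (le_of_tendsto' hlim2 hn)
  rw [bernoulliKL_symm h0 (by linarith), mul_comm]
  refine mul_le_mul_of_nonneg_right ?_ hT.le
  have := mul_le_mul_of_nonneg_left hD1 hc0
  have e : (1 - 2 * (δ : ℝ)) * Real.log ((1 - δ) / δ)
      = c * (1 - δ) - Real.log ((1 - δ) / δ) := by rw [hc]; ring
  rw [e]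
  exact sub_le_sub_right this _

end LowerBound
end

theorem proposition4 (E : ExpFamily) (K : ℕ) (hK : 2 ≤ K)
    (γ : ℝ) (hγ : γ ∈ E.means)
    (μ : Fin K → ℝ) (hμ : μ ∈ loadModels E K γ)
    (havail : correctAnswers γ μ ≠ {none})
    (k₀ : Fin K) (hk₀ : ∀ j, μ k₀ ≤ μ j) :
    (∃! y : ℝ, IsEquilibrium E μ k₀ (moreLoaded μ k₀) y) ∧
    ∀ y z : ℝ, IsEquilibrium E μ k₀ (moreLoaded μ k₀) y → z = min (E.d (μ k₀) γ) y →
      (∀ δ : unitInterval, 0 < δ → (δ : ℝ) ≤ 1 / 2 →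
        ∀ A : Algorithm K, A.IsPC E γ δ →
          ENNReal.ofReal (characteristicTime E μ k₀ z * bernoulliKL δ (unitInterval.symm δ))
            ≤ A.sampleComplexity E μ) ∧
      proportions E μ k₀ z ∈ stdSimplex ℝ (Fin K) ∧
      informationRate E γ μ (some k₀) (proportions E μ k₀ z)
        = (characteristicTime E μ k₀ z)⁻¹ ∧
      ∀ w ∈ stdSimplex ℝ (Fin K), w ≠ proportions E μ k₀ z →
        informationRate E γ μ (some k₀) w
          < informationRate E γ μ (some k₀) (proportions E μ k₀ z) := by
  have hmin : ∀ j, j ≠ k₀ → μ k₀ < μ j := by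
    intro j hj
    refine lt_of_le_of_ne (hk₀ j) fun heq => hj ?_
    exact hμ.2.1.unique (fun i => heq ▸ hk₀ i) hk₀
  have hav : μ k₀ < γ := by
    by_contra! hle
    refine havail (Set.eq_singleton_iff_unique_mem.2 ⟨fun k => hle.trans (hk₀ k), ?_⟩)
    intro a ha
    match a, ha with
    | none, _ => rfl
    | some k, ha => exact absurd (hle.trans (hk₀ k)) (not_le.2 ha.1)
  have hne : (moreLoaded μ k₀).Nonempty := by
    have : Nontrivial (Fin K) := Fin.nontrivial_iff_two_le.2 hK
    obtain ⟨j, hj⟩ := exists_ne k₀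
    exact ⟨j, mem_moreLoaded.2 (hmin j hj)⟩
  refine ⟨existsUnique_equilibrium hμ.1 hne, ?_⟩
  rintro y z hy rfl
  have h := isOptimalLevel_min hμ.1 hγ hmin hav hne hy
  exact ⟨fun δ hδ0 hδ A hA => h.le_sampleComplexity hμ (by exact_mod_cast hδ0) hδ A hA,
    h.proportions_mem_stdSimplex, h.informationRate_proportions,
    fun w hw hw' => h.informationRate_lt hw hw'⟩
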